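/- Let $n\ge 1$, $\Gamma=\mathrm{SL}_n(\mathbb Z)$ and $\mathcal H_n=\mathrm{PGL}_n(\mathbb R)/\mathrm{PO}(n)$. For a prime $p$ and $\mathbf a=(a_1,\dots,a_n)\in\mathbb Z^n$ write $\Gamma\,\mathrm{diag}(p^{a_1},\dots,p^{a_n})\,\Gamma=\bigsqcup_j\Gamma M_j$ (a finite disjoint union), and let $T_{\mathbf a}(p)$ be the Hecke operator $F\mapsto\sum_j F(M_j\,\cdot)$ on the space of all functions $F:\Gamma\backslash\mathcal H_n\to\mathbb C$. Put $T_{[j]}(p)=T_{(j,0,\dots,0)}(p)$ for $j\ge 0$, and let $\Pi(n)$ be the set of all integer tuples $\mathbf a=(a_1,\dots,a_n)$ with $a_1\ge\dots\ge a_n\ge0$ and $a_1+\dots+a_n=n$. A Hecke eigenform is a function $F\ne0$ on $\Gamma\backslash\mathcal H_n$ such that $T_{\mathbf a}(p)F=\lambda_{\mathbf a}(p,F)F$ for all primes $p$ and all $\mathbf a\in\mathbb Z^n$; write $\lambda_{[j]}(p,F)$ for its eigenvalue under $T_{[j]}(p)$. There are constants $C,c>0$ and $P$, depending only on $n$, such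 that for every prime $p\ge P$ there exist rational numbers $y_{\mathbf a}$ ($\mathbf a\in\Pi(n)$) with $|y_{\mathbf a}|\le C$ for all $\mathbf a$ and with the following two properties. (1) As operators on the functions on $\Gamma\backslash\mathcal H_n$, $$p^n\sum_{\mathbf a\in\Pi(n)}y_{\mathbf a}\prod_{j=1}^nT_{[a_j]}(p)=p^{n(n+1)/2}\,T_{(1,\dots,1)}(p)=p^{n(n+1)/2}\,\mathrm{id}.$$ (2) For every Hecke eigenform $F$ there is some $j$ with $1\le j\le n$ and $$\frac{|\lambda_{[j]}(p,F)|}{p^{j(n-1)/2}}\ \ge\ \Bigl(|\Pi(n)|\max_{\mathbf a\in\Pi(n)}|y_{\mathbf a}|\Bigr)^{-1}\qquad\text{and}\qquad\frac{|\lambda_{[j]}(p,F)|}{p^{j(n-1)/2}}\ \ge\ c .$$ -/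

import Mathlib

noncomputable section

namespace HeckePGL

open Matrix

/-- `SL_n(ℤ)` as a subgroup of `GL_n(ℝ)`. -/
def gammaGL (n : ℕ) : Subgroup (GL (Fin n) ℝ) :=
  (SpecialLinearGroup.mapGL ℝ : SpecialLinearGroup (Fin n) ℤ →* GL (Fin n) ℝ).range

/-- The image of `SL_n(ℤ)` in `PGL_n(ℝ)`. -/
def gammaPGL (n : ℕ) : Subgroup (ProjGenLinGroup (Fin n) ℝ) :=
  (gammaGL n).map ProjGenLinGroup.mk

/-- `PO(n)`, the image in `PGL_n(ℝ)` of the orthogonal group `O(n)`. -/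
def projOrthogonal (n : ℕ) : Subgroup (ProjGenLinGroup (Fin n) ℝ) :=
  (orthogonalGroup (Fin n) ℝ).units.map ProjGenLinGroup.mk

/-- The generalized upper half plane `ℋ_n = PGL_n(ℝ) / PO(n)`. -/
abbrev UpperHalf (n : ℕ) : Type :=
  ProjGenLinGroup (Fin n) ℝ ⧸ projOrthogonal n

/-- The quotient `Γ \ ℋ_n` with `Γ = SL_n(ℤ)`. -/
abbrev LocSym (n : ℕ) : Type :=
  MulAction.orbitRel.Quotient (gammaPGL n) (UpperHalf n)

/-- The class in `Γ \ ℋ_n` of a point of `ℋ_n`. -/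
def LocSym.mk {n : ℕ} (z : UpperHalf n) : LocSym n := Quotient.mk _ z

/-- The set `Γ \ GL_n(ℝ)` of all cosets `ΓM`, where `Γ = SL_n(ℤ)`. -/
abbrev CosetSpace (n : ℕ) : Type :=
  Quotient (QuotientGroup.rightRel (gammaGL n))

/-- The set of the cosets `ΓM` that are contained in the double coset `ΓAΓ`. -/
def cosetsIn {n : ℕ} (A : GL (Fin n) ℝ) : Set (CosetSpace n) :=
  (fun M : GL (Fin n) ℝ => (Quotient.mk _ M : CosetSpace n)) ''
    DoubleCoset.doubleCoset A (gammaGL n) (gammaGL n)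

theorem LocSym.mk_smul {n : ℕ} {g : GL (Fin n) ℝ} (hg : g ∈ gammaGL n) (z : UpperHalf n) :
    LocSym.mk (ProjGenLinGroup.mk g • z) = LocSym.mk z :=
  Quotient.sound ⟨⟨ProjGenLinGroup.mk g, Subgroup.mem_map_of_mem _ hg⟩, rfl⟩

/-- For `z ∈ ℋ_n`, the map `ΓM ↦ ΓMz`. -/
def translate {n : ℕ} (z : UpperHalf n) : CosetSpace n → LocSym n :=
  Quotient.lift (fun M : GL (Fin n) ℝ => LocSym.mk (ProjGenLinGroup.mk M • z)) (by
    intro M N h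
    have h' : N * M⁻¹ ∈ gammaGL n := QuotientGroup.rightRel_apply.1 h
    have := LocSym.mk_smul h' (ProjGenLinGroup.mk M • z)
    rw [smul_smul, ← map_mul, inv_mul_cancel_right] at this
    exact this.symm)

/-- The sum `∑_j F(M_j z)`, where `ΓAΓ` is the disjoint union of the cosets `ΓM_j`. -/
def cosetSum {n : ℕ} (A : GL (Fin n) ℝ) (F : LocSym n → ℂ) (z : UpperHalf n) : ℂ :=
  ∑ᶠ q ∈ cosetsIn A, F (translate z q)

/-- Right multiplication by `g` on the cosets: `ΓM ↦ ΓMg`. -/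
def rightMul {n : ℕ} (g : GL (Fin n) ℝ) : CosetSpace n → CosetSpace n :=
  Quotient.map (· * g) (by
    intro M N h
    have h' : N * M⁻¹ ∈ gammaGL n := QuotientGroup.rightRel_apply.1 h
    refine QuotientGroup.rightRel_apply.2 ?_
    simpa [mul_assoc] using h')

theorem rightMul_rightMul {n : ℕ} (g h : GL (Fin n) ℝ) (q : CosetSpace n) :
    rightMul h (rightMul g q) = rightMul (g * h) q := by
  induction q using Quotient.inductionOn with
  | h M => exact congrArg (Quotient.mk _) (mul_assoc M g h)

theorem rightMul_one {n : ℕ} (q : CosetSpace n) : rightMul 1 q = q := by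
  induction q using Quotient.inductionOn with
  | h M => exact congrArg (Quotient.mk _) (mul_one M)

theorem rightMul_mem {n : ℕ} {A g : GL (Fin n) ℝ} (hg : g ∈ gammaGL n) {q : CosetSpace n}
    (hq : q ∈ cosetsIn A) : rightMul g q ∈ cosetsIn A := by
  obtain ⟨M, hM, rfl⟩ := hq
  obtain ⟨x, hx, y, hy, rfl⟩ := DoubleCoset.mem_doubleCoset.1 hM
  exact ⟨x * A * y * g, DoubleCoset.mem_doubleCoset.2
    ⟨x, hx, y * g, (gammaGL n).mul_mem hy hg, by rw [mul_assoc (x * A)]⟩, rfl⟩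

theorem translate_smul {n : ℕ} (g : GL (Fin n) ℝ) (z : UpperHalf n) (q : CosetSpace n) :
    translate (ProjGenLinGroup.mk g • z) q = translate z (rightMul g q) := by
  induction q using Quotient.inductionOn with
  | h M =>
    change LocSym.mk _ = LocSym.mk (ProjGenLinGroup.mk (M * g) • z)
    rw [smul_smul, map_mul]

theorem cosetSum_smul {n : ℕ} (A : GL (Fin n) ℝ) (F : LocSym n → ℂ) {g : GL (Fin n) ℝ}
    (hg : g ∈ gammaGL n) (z : UpperHalf n) :
    cosetSum A F (ProjGenLinGroup.mk g • z) = cosetSum A F z := by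
  unfold cosetSum
  refine finsum_mem_eq_of_bijOn (rightMul g) ⟨fun q hq => rightMul_mem hg hq, ?_, ?_⟩
    (fun q _ => by rw [translate_smul])
  · intro q _ r _ h
    have := congrArg (rightMul g⁻¹) h
    simpa only [rightMul_rightMul, mul_inv_cancel, rightMul_one] using this
  · intro q hq
    refine ⟨rightMul g⁻¹ q, rightMul_mem ((gammaGL n).inv_mem hg) hq, ?_⟩
    rw [rightMul_rightMul, inv_mul_cancel, rightMul_one]

/-- The invertible diagonal matrix `diag(p^{a_1}, …, p^{a_n})`. -/
def diagPow {n : ℕ} (p : Nat.Primes) (a : Fin n → ℤ) : GL (Fin n) ℝ where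
  val := diagonal fun i => (p : ℝ) ^ a i
  inv := diagonal fun i => (p : ℝ) ^ (-a i)
  val_inv := by
    have hp : ((p : ℕ) : ℝ) ≠ 0 := Nat.cast_ne_zero.2 p.2.ne_zero
    rw [diagonal_mul_diagonal, ← diagonal_one]
    congr 1
    funext i
    rw [← zpow_add₀ hp, add_neg_cancel, zpow_zero]
  inv_val := by
    have hp : ((p : ℕ) : ℝ) ≠ 0 := Nat.cast_ne_zero.2 p.2.ne_zero
    rw [diagonal_mul_diagonal, ← diagonal_one]
    congr 1
    funext i
    rw [← zpow_add₀ hp, neg_add_cancel, zpow_zero]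

theorem smul_diagonal_int {n : ℕ} (p : Nat.Primes) (K : ℕ) (b : Fin n → ℤ)
    (hb : ∀ i, 0 ≤ (K : ℤ) + b i) :
    ((diagonal fun i => (p : ℤ) ^ ((K : ℤ) + b i).toNat : Matrix (Fin n) (Fin n) ℤ).map
      (Int.cast : ℤ → ℝ)) = (p : ℝ) ^ K • diagonal fun i => (p : ℝ) ^ b i := by
  have hp : ((p : ℕ) : ℝ) ≠ 0 := Nat.cast_ne_zero.2 p.2.ne_zero
  rw [diagonal_map (by simp), ← diagonal_smul]
  congr 1
  funext i
  simp only [Pi.smul_apply, smul_eq_mul, Int.cast_pow, Int.cast_natCast]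
  rw [← zpow_natCast, ← zpow_natCast, Int.toNat_of_nonneg (hb i), zpow_add₀ hp]

theorem exists_integral {n : ℕ} (p : Nat.Primes) (a : Fin n → ℤ) {M : GL (Fin n) ℝ}
    (hM : M ∈ DoubleCoset.doubleCoset (diagPow p a) (gammaGL n : Set (GL (Fin n) ℝ))
      (gammaGL n)) :
    (M : Matrix (Fin n) (Fin n) ℝ).det = (diagPow p a : Matrix (Fin n) (Fin n) ℝ).det ∧
    (∃ X : Matrix (Fin n) (Fin n) ℤ, X.map (Int.cast : ℤ → ℝ) =
      (p : ℝ) ^ (∑ i, (a i).natAbs) • (M : Matrix (Fin n) (Fin n) ℝ)) ∧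
    ∃ Y : Matrix (Fin n) (Fin n) ℤ, Y.map (Int.cast : ℤ → ℝ) =
      (p : ℝ) ^ (∑ i, (a i).natAbs) • ((M⁻¹ : GL (Fin n) ℝ) : Matrix (Fin n) (Fin n) ℝ) := by
  obtain ⟨x, ⟨g, rfl⟩, y, ⟨h, rfl⟩, rfl⟩ := DoubleCoset.mem_doubleCoset.1 hM
  set K := ∑ i, (a i).natAbs with hK
  have hle : ∀ i, (a i).natAbs ≤ K := fun i =>
    Finset.single_le_sum (f := fun i => (a i).natAbs) (fun _ _ => Nat.zero_le _)
      (Finset.mem_univ i)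
  refine ⟨?_, ⟨g.1 * (diagonal fun i => (p : ℤ) ^ ((K : ℤ) + a i).toNat) * h.1, ?_⟩,
    ⟨(h⁻¹).1 * (diagonal fun i => (p : ℤ) ^ ((K : ℤ) + -a i).toNat) * (g⁻¹).1, ?_⟩⟩
  · have h1 : ∀ g : SpecialLinearGroup (Fin n) ℤ,
        ((SpecialLinearGroup.mapGL ℝ g : GL (Fin n) ℝ) : Matrix (Fin n) (Fin n) ℝ).det = 1 := by
      intro g
      exact congrArg Units.val (SpecialLinearGroup.det_mapGL (S := ℝ) g)
    rw [Units.val_mul, Units.val_mul, det_mul, det_mul, h1, h1, one_mul, mul_one]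
  · rw [Matrix.map_mul_intCast, Matrix.map_mul_intCast,
      smul_diagonal_int p K a (fun i => by have := hle i; omega)]
    simp only [Units.val_mul, SpecialLinearGroup.mapGL_coe_matrix]
    rw [Matrix.mul_smul, Matrix.smul_mul]
    rfl
  · rw [Matrix.map_mul_intCast, Matrix.map_mul_intCast,
      smul_diagonal_int p K (fun i => -a i) (fun i => by have := hle i; omega)]
    rw [_root_.mul_inv_rev, _root_.mul_inv_rev, ← map_inv, ← map_inv]
    simp only [Units.val_mul, SpecialLinearGroup.mapGL_coe_matrix]
    rw [Matrix.mul_smul, Matrix.smul_mul, ← mul_assoc]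
    rfl

/-- The double coset of `diag(p^{a_1}, …, p^{a_n})` is a finite union of cosets `ΓM`. -/
theorem cosetsIn_finite {n : ℕ} (p : Nat.Primes) (a : Fin n → ℤ) :
    (cosetsIn (diagPow p a)).Finite := by
  classical
  have hp : ((p : ℕ) : ℝ) ≠ 0 := Nat.cast_ne_zero.2 p.2.ne_zero
  set K := ∑ i, (a i).natAbs with hK
  have : NeZero ((p : ℕ) ^ (K + K)) := ⟨pow_ne_zero _ p.2.ne_zero⟩
  have key : ∀ q : CosetSpace n, ∃ X : Matrix (Fin n) (Fin n) ℤ, q ∈ cosetsIn (diagPow p a) →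
      ∃ M : GL (Fin n) ℝ, M ∈ DoubleCoset.doubleCoset (diagPow p a)
        (gammaGL n : Set (GL (Fin n) ℝ)) (gammaGL n) ∧ (Quotient.mk _ M : CosetSpace n) = q ∧
        X.map (Int.cast : ℤ → ℝ) = (p : ℝ) ^ K • (M : Matrix (Fin n) (Fin n) ℝ) := by
    intro q
    by_cases hq : q ∈ cosetsIn (diagPow p a)
    · obtain ⟨M, hM, rfl⟩ := hq
      obtain ⟨-, ⟨X, hX⟩, -⟩ := exists_integral p a hM
      exact ⟨X, fun _ => ⟨M, hM, rfl, hX⟩⟩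
    · exact ⟨0, fun h => absurd h hq⟩
  choose X hX using key
  refine Set.Finite.of_finite_image (f := fun q =>
    (X q).map (Int.cast : ℤ → ZMod ((p : ℕ) ^ (K + K)))) (Set.toFinite _) ?_
  intro q hq r hr hqr
  obtain ⟨M, hM, hMq, hXM⟩ := hX q hq
  obtain ⟨N, hN, hNr, hXN⟩ := hX r hr
  obtain ⟨hdM, -, Y, hY⟩ := exists_integral p a hM
  obtain ⟨hdN, -, -⟩ := exists_integral p a hN
  have hdiv : ∀ i j, ∃ z : ℤ, X r i j = X q i j + ((p : ℕ) ^ (K + K) : ℕ) * z := by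
    intro i j
    have h1 : ((X q i j : ℤ) : ZMod ((p : ℕ) ^ (K + K))) = (X r i j : ℤ) :=
      congrFun (congrFun hqr i) j
    obtain ⟨z, hz⟩ := (ZMod.intCast_eq_intCast_iff_dvd_sub _ _ _).1 h1
    exact ⟨z, by rw [← hz]; ring⟩
  choose z hz using hdiv
  let Z : Matrix (Fin n) (Fin n) ℤ := of z
  have hXZ : X r = X q + ((p : ℤ) ^ (K + K)) • Z := by
    ext i j
    simp [Z, hz i j]
  have hMinv : (M : Matrix (Fin n) (Fin n) ℝ) *
      ((M⁻¹ : GL (Fin n) ℝ) : Matrix (Fin n) (Fin n) ℝ) = 1 := by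
    rw [← Units.val_mul, mul_inv_cancel, Units.val_one]
  have hW : (1 + Z * Y).map (Int.cast : ℤ → ℝ) =
      (N : Matrix (Fin n) (Fin n) ℝ) * ((M⁻¹ : GL (Fin n) ℝ) : Matrix (Fin n) (Fin n) ℝ) := by
    have h2 : (N : Matrix (Fin n) (Fin n) ℝ) =
        (M : Matrix (Fin n) (Fin n) ℝ) + (p : ℝ) ^ K • Z.map (Int.cast : ℤ → ℝ) := by
      have h3 : (p : ℝ) ^ K • (N : Matrix (Fin n) (Fin n) ℝ) =
          (p : ℝ) ^ K • ((M : Matrix (Fin n) (Fin n) ℝ) +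
            (p : ℝ) ^ K • Z.map (Int.cast : ℤ → ℝ)) := by
        rw [← hXN, hXZ, smul_add, ← hXM, smul_smul, ← pow_add]
        ext i j
        simp only [Matrix.map_apply, Matrix.add_apply, Matrix.smul_apply, smul_eq_mul]
        push_cast
        ring
      exact smul_right_injective _ (pow_ne_zero K hp) h3
    rw [h2, add_mul, hMinv, Matrix.smul_mul, ← Matrix.mul_smul, ← hY,
      Matrix.map_add _ Int.cast_add, Matrix.map_one _ Int.cast_zero Int.cast_one,
      Matrix.map_mul_intCast]
  have hdet : (1 + Z * Y).det = 1 := by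
    have h4 := congrArg det hW
    rw [det_mul, hdN, ← hdM, ← det_mul, hMinv, det_one, ← Int.cast_det] at h4
    exact_mod_cast h4
  rw [← hMq, ← hNr]
  refine Quotient.sound (QuotientGroup.rightRel_apply.2 ⟨⟨1 + Z * Y, hdet⟩, ?_⟩)
  apply Units.ext
  exact hW

/-- The Hecke operator `T_𝐚(p) : F ↦ ∑_j F(M_j ·)` on all functions `F : Γ \ ℋ_n → ℂ`, where
`Γ diag(p^{a_1}, …, p^{a_n}) Γ` is the disjoint union of the cosets `ΓM_j`. -/
def heckeT {n : ℕ} (p : Nat.Primes) (a : Fin n → ℤ) : Module.End ℂ (LocSym n → ℂ) where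
  toFun F := Quotient.lift (cosetSum (diagPow p a) F) (by
    rintro z w ⟨⟨_, g, hg, rfl⟩, rfl⟩
    exact cosetSum_smul _ F hg w)
  map_add' F G := by
    funext x
    induction x using Quotient.inductionOn with
    | h z => exact finsum_mem_add_distrib (cosetsIn_finite p a)
  map_smul' c F := by
    funext x
    induction x using Quotient.inductionOn with
    | h z => exact (smul_finsum_mem (N := ℂ) (r := c)
      (f := fun q => F (translate z q)) (cosetsIn_finite p a)).symm

/-- The tuple `(j, 0, …, 0)`. -/
def rowTuple (n j : ℕ) : Fin n → ℤ := fun i => if (i : ℕ) = 0 then (j : ℤ) else 0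

/-- The Hecke operator `T_{[j]}(p) = T_{(j, 0, …, 0)}(p)`. -/
def heckeRow (n : ℕ) (p : Nat.Primes) (j : ℕ) : Module.End ℂ (LocSym n → ℂ) :=
  heckeT p (rowTuple n j)

/-- The set `Π(n)` of partitions of `n`, written as non-increasing `n`-tuples `a_1 ≥ … ≥ a_n ≥ 0`
of integers with `a_1 + … + a_n = n`. -/
def partitionTuples (n : ℕ) : Finset (Fin n → ℕ) :=
  (Finset.piAntidiag Finset.univ n).filter fun a => ∀ i j, i ≤ j → a j ≤ a i

/-- `F` is an eigenform of the full Hecke algebra, `lam p a` being its eigenvalue `λ_𝐚(p, F)`. -/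
structure IsHeckeEigenform {n : ℕ} (F : LocSym n → ℂ)
    (lam : Nat.Primes → (Fin n → ℤ) → ℂ) : Prop where
  ne_zero : F ≠ 0
  eigen : ∀ (p : Nat.Primes) (a : Fin n → ℤ), heckeT p a F = lam p a • F

end HeckePGL

end

/-!
Write `W = ℤⁿ` (row vectors) and `t = 1 / p`. Sending a matrix to the subgroup that its rows span
identifies the cosets `ΓM` of integral `M` with `det M > 0` with the subgroups of `W` of finite
index, and `Γ diag(p ^ m, 1, …, 1) Γ` with those subgroups `L` for which `W / L` is cyclic of order
`p ^ m` (`heckeRow_eq_latOp`). So the Hecke operators in question are sums over subgroups with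
prescribed quotient (`latOp`), and in the product of two of them the subgroup `K` occurs with
multiplicity the number of subgroups `H` of `G = W / K` with `G / H` and `H` of prescribed type
(`latOp_mul_apply`). Identities between such operators are thus counting identities for finite
abelian groups `G`; commutativity is the duality `H ↦ H^⊥` (`pairCount_comm`).

Let `R_m` be the operator of cyclic quotients of order `p ^ m` and `E_i` the operator of elementary
abelian quotients of order `p ^ i`, multiplied by `p ^ (i (i - 1) / 2)`. They correspond to one-row
Hall–Littlewood functions and elementary symmetric functions, and satisfy
`(1 - t ^ N) E_N = ∑_{i < N} (-1) ^ (N - 1 - i) (1 - t) E_i R_{N - i}` for `N ≥ 1`. As a counting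
identity (`sum_pairCount`), this concerns the cyclic subgroups of `G` that contain `p G`. Counting
their generators `g` instead, an alternating sum over the `g` with `p G ≤ ⟨g⟩` remains; if
`p G ≠ 0`, such a `g` either generates `p G` or is mapped to a generator of `p G` by multiplication
with `p`, and the contributions of the two kinds cancel (`generatorCount_of_not_elementary`).

By induction, `E_n` is a combination of the products of the `R_j` over the partitions of `n`, with
coefficients that depend only on `t` and are bounded uniformly in it (`exists_universal_coeff`).
Since `E_n` is `p ^ (n (n - 1) / 2)` times the operator of the single subgroup `p W`, that is, of a
scalar matrix, the first claim follows.

On an eigenform the identity becomes `1 = ∑ y_a ∏ x_{a_j}` with normalized eigenvalues `x_j` and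
`x_0 = 1`, so some product has absolute value at least `(|Π(n)| max |y_a|)⁻¹`. If this number is at
most `1`, then one of the factors is at least as large (`exists_factor_ge`). That it is at most `1`
means that the `y_a` are not too small, and follows by evaluating the universal identity at
`R_j = (-1) ^ (j - 1)`, where all terms of the recursion are positive and `E_n ≥ 1`
(`exists_isRowRecursion_one_le`). No lower bound on `p` is needed.
-/

noncomputable section

namespace HeckePGL

/-! ### Classes of finite abelian groups, and generators of cyclic subgroups -/

/-- An isomorphism-invariant class of finite abelian groups of one fixed order. -/
structure FiniteGroupType where
  /-- Membership in the class. -/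
  mem : ∀ (G : Type) [AddCommGroup G], Prop
  /-- The common order of the groups in the class. -/
  order : ℕ
  order_ne_zero : order ≠ 0
  of_equiv : ∀ {G H : Type} [AddCommGroup G] [AddCommGroup H], (G ≃+ H) → mem G → mem H
  card_eq : ∀ {G : Type} [AddCommGroup G], mem G → Nat.card G = order

/-- The class of cyclic groups of order `p ^ m`. -/
def cyclicType (p : ℕ) [hp : Fact p.Prime] (m : ℕ) : FiniteGroupType where
  mem G _ := IsAddCyclic G ∧ Nat.card G = p ^ m
  order := p ^ m
  order_ne_zero := pow_ne_zero _ hp.out.ne_zero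
  of_equiv e h := ⟨(e.isAddCyclic).1 h.1, (Nat.card_congr e.toEquiv).symm.trans h.2⟩
  card_eq h := h.2

/-- The class of elementary abelian `p`-groups of order `p ^ i`. -/
def elementaryType (p : ℕ) [hp : Fact p.Prime] (i : ℕ) : FiniteGroupType where
  mem G _ := (∀ g : G, p • g = 0) ∧ Nat.card G = p ^ i
  order := p ^ i
  order_ne_zero := pow_ne_zero _ hp.out.ne_zero
  of_equiv e h := ⟨fun g => by
    have := congrArg e (h.1 (e.symm g))
    simpa using this, (Nat.card_congr e.toEquiv).symm.trans h.2⟩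
  card_eq h := h.2

/-- The number of subgroups `H ≤ G` with `G ⧸ H` in the class `Q` and `H` in the class `R`. -/
def pairCount (Q R : FiniteGroupType) (G : Type) [AddCommGroup G] : ℕ :=
  Nat.card {H : AddSubgroup G // Q.mem (G ⧸ H) ∧ R.mem H}

/-- The number of `g ∈ G` of order `p ^ m` such that `⟨g⟩` contains `p G`. -/
def generatorCount (p : ℕ) (m : ℕ) (G : Type) [AddCommGroup G] : ℕ :=
  Nat.card {g : G // addOrderOf g = p ^ m ∧ ∀ x : G, p • x ∈ AddSubgroup.zmultiples g}

/-- Primes in the bundled sense give instances of `Fact`. -/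
instance fact_prime_of_primes (p : Nat.Primes) : Fact (p : ℕ).Prime := ⟨p.2⟩

theorem card_generators {G : Type} [AddCommGroup G] [Finite G] (H : AddSubgroup G) [IsAddCyclic H] :
    Nat.card {g : G // AddSubgroup.zmultiples g = H} = (Nat.card H).totient := by
  classical
  have := Fintype.ofFinite H
  have := Fintype.ofFinite G
  have h := IsAddCyclic.card_addOrderOf_eq_totient (α := H) (d := Fintype.card H) dvd_rfl
  rw [Nat.card_eq_fintype_card (α := H), ← h, ← Fintype.card_subtype, ← Nat.card_eq_fintype_card]
  have key : ∀ g : H, addOrderOf g = Fintype.card H ↔ AddSubgroup.zmultiples (g : G) = H := by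
    intro g
    rw [← Nat.card_eq_fintype_card, ← AddSubgroup.addOrderOf_coe, ← Nat.card_zmultiples]
    refine ⟨fun h => AddSubgroup.eq_of_le_of_card_ge ?_ h.ge, fun h => by rw [h]⟩
    rw [AddSubgroup.zmultiples_le]
    exact g.2
  refine Nat.card_congr ⟨fun g => ⟨⟨g.1, by
    have := AddSubgroup.mem_zmultiples g.1
    rwa [g.2] at this⟩, (key _).2 g.2⟩, fun g => ⟨g.1.1, (key _).1 g.2⟩, fun g => rfl, fun g => rfl⟩

theorem elementary_quotient_iff {G : Type} [AddCommGroup G] {p : ℕ} [hp : Fact p.Prime] {N : ℕ}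
    (hG : Nat.card G = p ^ N) {i : ℕ} (hi : i ≤ N)
    (H : AddSubgroup G) : (elementaryType p i).mem (G ⧸ H) ↔
      (∀ x : G, p • x ∈ H) ∧ Nat.card H = p ^ (N - i) := by
  have hc := AddSubgroup.card_eq_card_quotient_mul_card_addSubgroup H
  rw [hG, ← pow_mul_pow_sub p hi] at hc
  have hp := hp.out.pos
  have h1 : (∀ g : G ⧸ H, p • g = 0) ↔ ∀ x : G, p • x ∈ H := by
    refine ⟨fun h x => ?_, fun h g => ?_⟩
    · exact (QuotientAddGroup.eq_zero_iff _).1 (h (x : G ⧸ H))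
    · obtain ⟨x, rfl⟩ := QuotientAddGroup.mk_surjective g
      exact (QuotientAddGroup.eq_zero_iff _).2 (h x)
  refine and_congr h1 ⟨fun h => ?_, fun h => ?_⟩
  · rw [h] at hc
    exact (Nat.eq_of_mul_eq_mul_left (pow_pos hp i) hc).symm
  · rw [h] at hc
    exact (Nat.eq_of_mul_eq_mul_right (pow_pos hp _) hc).symm

/-- A cyclic group of order `p ^ m` has `φ(p ^ m)` generators. -/
theorem pairCount_mul_totient {G : Type} [AddCommGroup G] [Finite G] {p : ℕ}
    [hp : Fact p.Prime] {N : ℕ} (hG : Nat.card G = p ^ N) {i : ℕ} (hi : i ≤ N) :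
    pairCount (elementaryType p i) (cyclicType p (N - i)) G * (p ^ (N - i)).totient
      = generatorCount p (N - i) G := by
  classical
  have := Fintype.ofFinite {H : AddSubgroup G //
    (elementaryType p i).mem (G ⧸ H) ∧ (cyclicType p (N - i)).mem H}
  let f : {g : G // addOrderOf g = p ^ (N - i) ∧
      ∀ x : G, p • x ∈ AddSubgroup.zmultiples g} →
      {H : AddSubgroup G // (elementaryType p i).mem (G ⧸ H) ∧ (cyclicType p (N - i)).mem H} :=
    fun g => ⟨AddSubgroup.zmultiples g.1, (elementary_quotient_iff hG hi _).2
      ⟨g.2.2, by rw [Nat.card_zmultiples, g.2.1]⟩, inferInstance,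
        by rw [Nat.card_zmultiples, g.2.1]⟩
  rw [generatorCount, ← Nat.card_congr (Equiv.sigmaFiberEquiv f), Nat.card_sigma, pairCount]
  have : ∀ H : {H : AddSubgroup G // (elementaryType p i).mem (G ⧸ H) ∧
      (cyclicType p (N - i)).mem H}, Nat.card {g // f g = H} = (p ^ (N - i)).totient := by
    rintro ⟨H, hH⟩
    have := hH.2.1
    refine Eq.trans ?_ ((card_generators H).trans (congrArg _ hH.2.2))
    refine Nat.card_congr ⟨fun g => ⟨g.1.1, congrArg Subtype.val g.2⟩,
      fun g => ⟨⟨g.1, ?_, ?_⟩, Subtype.ext g.2⟩, fun g => rfl, fun g => rfl⟩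
    · rw [← Nat.card_zmultiples, g.2, hH.2.2]
    · rw [g.2]
      exact ((elementary_quotient_iff hG hi H).1 hH.1).1
  rw [Finset.sum_congr rfl fun H _ => this H, Finset.sum_const, Finset.card_univ, smul_eq_mul,
    Nat.card_eq_fintype_card]

theorem generatorCount_of_elementary {G : Type} [AddCommGroup G] [Finite G] {p : ℕ}
    [hp : Fact p.Prime] {N : ℕ} (hG : Nat.card G = p ^ N)
    (h : ∀ g : G, p • g = 0) :
    generatorCount p 0 G = 1 ∧ generatorCount p 1 G + 1 = p ^ N ∧
      ∀ m, 2 ≤ m → generatorCount p m G = 0 := by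
  classical
  have := Fintype.ofFinite G
  have h0 : ∀ g : G, addOrderOf g = p ^ 1 ↔ g ≠ 0 := by
    intro g
    rw [pow_one]
    refine ⟨?_, fun hg => ?_⟩
    · rintro h rfl
      rw [addOrderOf_zero] at h
      exact hp.out.one_lt.ne h
    · have := Fact.mk hp.out
      exact addOrderOf_eq_prime (h g) hg
  simp only [generatorCount, h, zero_mem, implies_true, and_true]
  refine ⟨?_, ?_, fun m hm => ?_⟩
  · simp
  · simp only [h0]
    rw [← hG, Nat.card_eq_fintype_card, Nat.card_eq_fintype_card, Fintype.card_subtype_compl]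
    simp only [Fintype.card_unique]
    have := Fintype.card_pos (α := G)
    omega
  · rw [Nat.card_eq_zero]
    refine Or.inl ⟨fun ⟨g, hg⟩ => ?_⟩
    have := addOrderOf_dvd_of_nsmul_eq_zero (h g)
    rw [hg] at this
    have := (Nat.pow_dvd_pow_iff_le_right (l := 1) hp.out.one_lt).1 (by simpa using this)
    omega

/-- If `p G ≠ 0`, let `p ^ k` be the order of `p G`. An element `g` with `p G ≤ ⟨g⟩` either
generates `p G` (order `p ^ k`) or is mapped to a generator of `p G` by multiplication with `p`
(order `p ^ (k + 1)`), as `p ⟨g⟩ ≤ p G ≤ ⟨g⟩`. The elements of the second kind are the preimages of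
those of the first, and the kernel of multiplication by `p` has order `p ^ (N - k)`. -/
theorem generatorCount_of_not_elementary {G : Type} [AddCommGroup G] [Finite G] {p : ℕ}
    [hp : Fact p.Prime] {N : ℕ} (hG : Nat.card G = p ^ N)
    (h : ¬ ∀ g : G, p • g = 0) :
    ∃ k, k + 1 ≤ N ∧
      generatorCount p (k + 1) G = p ^ (N - k) * generatorCount p k G ∧
      ∀ m, m ≠ k → m ≠ k + 1 → generatorCount p m G = 0 := by
  classical
  have hp1 := hp.out.one_lt
  let μ : G →+ G := nsmulAddMonoidHom p
  have hμ : ∀ g, μ g = p • g := fun _ => rfl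
  obtain ⟨k, hkN, hk⟩ := (Nat.dvd_prime_pow hp.out).1
    (hG ▸ AddSubgroup.card_addSubgroup_dvd_card μ.range)
  have hord : ∀ g : G, ∃ j, addOrderOf g = p ^ j := fun g =>
    let ⟨j, _, hj⟩ := (Nat.dvd_prime_pow hp.out).1 (hG ▸ addOrderOf_dvd_natCard g)
    ⟨j, hj⟩
  have hordp : ∀ (g : G) (j : ℕ), addOrderOf g = p ^ (j + 1) →
      addOrderOf (μ g) = p ^ j := by
    intro g j hj
    rw [hμ, addOrderOf_nsmul_of_dvd hp.out.ne_zero (by rw [hj, pow_succ]; exact dvd_mul_left _ _),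
      hj, pow_succ, Nat.mul_div_cancel _ hp.out.pos]
  have hle : ∀ g : G, (∀ x : G, p • x ∈ AddSubgroup.zmultiples g) ↔
      μ.range ≤ AddSubgroup.zmultiples g := by
    intro g
    constructor
    · rintro hx _ ⟨x, rfl⟩
      exact hx x
    · exact fun hx x => hx ⟨x, rfl⟩
  have hne : ∀ g : G, (∀ x : G, p • x ∈ AddSubgroup.zmultiples g) → g ≠ 0 := by
    rintro _ hx rfl
    exact h (by simpa using hx)
  have hmem : ∀ g : G, μ g ∈ μ.range := fun g => ⟨g, rfl⟩
  have hker : Nat.card μ.ker = p ^ (N - k) := by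
    have h1 := AddSubgroup.card_eq_card_quotient_mul_card_addSubgroup μ.ker
    rw [Nat.card_congr (QuotientAddGroup.quotientKerEquivRange μ).toEquiv, hk, hG,
      ← pow_mul_pow_sub p hkN] at h1
    exact (Nat.eq_of_mul_eq_mul_left (pow_pos hp.out.pos k) h1).symm
  -- multiplication by `p` is not injective on a nontrivial `p`-group
  have hk0 : k ≠ N := by
    rintro rfl
    obtain ⟨g, hg⟩ := not_forall.1 h
    have h3 : (⊥ : AddSubgroup G) < μ.ker := by
      rw [Nat.sub_self, pow_zero] at hker
      obtain ⟨j, hj⟩ := hord g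
      have hj0 : j ≠ 0 := by
        rintro rfl
        rw [pow_zero, AddMonoid.addOrderOf_eq_one_iff] at hj
        simp [hj] at hg
      obtain ⟨j, rfl⟩ := Nat.exists_eq_succ_of_ne_zero hj0
      rw [bot_lt_iff_ne_bot]
      intro hb
      have h4 : p ^ j • g ∈ μ.ker := by
        rw [AddMonoidHom.mem_ker, hμ, smul_smul, mul_comm, ← pow_succ, ← Nat.succ_eq_add_one, ← hj]
        exact addOrderOf_nsmul_eq_zero g
      rw [hb, AddSubgroup.mem_bot] at h4
      have h5 := addOrderOf_dvd_of_nsmul_eq_zero h4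
      rw [hj] at h5
      have := (Nat.pow_dvd_pow_iff_le_right hp1).1 h5
      omega
    have h4 : μ.ker = ⊥ := by
      apply AddSubgroup.eq_bot_of_card_eq
      rw [hker, Nat.sub_self, pow_zero]
    exact h3.ne' h4
  have hA : ∀ g : G, (addOrderOf g = p ^ k ∧
      ∀ x : G, p • x ∈ AddSubgroup.zmultiples g) ↔ AddSubgroup.zmultiples g = μ.range := by
    intro g
    rw [hle, ← Nat.card_zmultiples, ← hk]
    refine ⟨fun ⟨h1, h2⟩ => (AddSubgroup.eq_of_le_of_card_ge h2 h1.le).symm, fun h1 => ?_⟩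
    rw [h1]
    exact ⟨rfl, le_rfl⟩
  have hB : ∀ g : G, (addOrderOf g = p ^ (k + 1) ∧
      ∀ x : G, p • x ∈ AddSubgroup.zmultiples g) ↔
      AddSubgroup.zmultiples (μ g) = μ.range := by
    intro g
    constructor
    · rintro ⟨h1, h2⟩
      refine AddSubgroup.eq_of_le_of_card_ge ?_ ?_
      · rw [AddSubgroup.zmultiples_le]; exact hmem g
      · rw [Nat.card_zmultiples, hordp g k h1, hk]
    · intro h1
      have h2 : ∀ x : G, p • x ∈ AddSubgroup.zmultiples g := by
        rw [hle, ← h1, AddSubgroup.zmultiples_le, hμ]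
        exact AddSubgroup.nsmul_mem _ (AddSubgroup.mem_zmultiples g) _
      refine ⟨?_, h2⟩
      obtain ⟨j, hj⟩ := hord g
      have hj0 : j ≠ 0 := by
        rintro rfl
        rw [pow_zero, AddMonoid.addOrderOf_eq_one_iff] at hj
        exact hne g h2 hj
      obtain ⟨j, rfl⟩ := Nat.exists_eq_succ_of_ne_zero hj0
      have h3 := hordp g j hj
      rw [← Nat.card_zmultiples, h1, hk] at h3
      rw [hj, Nat.pow_right_injective hp1 h3]
  refine ⟨k, by omega, ?_, ?_⟩
  · unfold generatorCount
    rw [Nat.card_congr (Equiv.subtypeEquivRight hA), Nat.card_congr (Equiv.subtypeEquivRight hB)]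
    let f : {g : G // AddSubgroup.zmultiples (μ g) = μ.range} →
        {g : G // AddSubgroup.zmultiples g = μ.range} := fun g => ⟨μ g.1, g.2⟩
    have := Fintype.ofFinite {g : G // AddSubgroup.zmultiples g = μ.range}
    rw [← Nat.card_congr (Equiv.sigmaFiberEquiv f), Nat.card_sigma]
    have : ∀ b : {g : G // AddSubgroup.zmultiples g = μ.range},
        Nat.card {g // f g = b} = p ^ (N - k) := by
      rintro ⟨b, hb⟩
      have hb' : b ∈ μ.range := hb ▸ AddSubgroup.mem_zmultiples b
      obtain ⟨c, rfl⟩ := hb'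
      rw [← hker]
      refine Nat.card_congr ⟨fun g => ⟨g.1.1 - c, ?_⟩, fun g => ⟨⟨g.1 + c, ?_⟩, ?_⟩,
        fun g => ?_, fun g => ?_⟩
      · have := congrArg Subtype.val g.2
        rw [AddMonoidHom.mem_ker, map_sub, sub_eq_zero]
        exact this
      · rw [map_add, AddMonoidHom.mem_ker.1 g.2, zero_add, hb]
      · apply Subtype.ext
        change μ (g.1 + c) = μ c
        rw [map_add, AddMonoidHom.mem_ker.1 g.2, zero_add]
      · apply Subtype.ext; apply Subtype.ext
        simp
      · apply Subtype.ext
        simp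
    rw [Finset.sum_congr rfl fun b _ => this b, Finset.sum_const, Finset.card_univ, smul_eq_mul,
      Nat.card_eq_fintype_card, mul_comm]
  · intro m hm1 hm2
    rw [generatorCount, Nat.card_eq_zero]
    refine Or.inl ⟨fun ⟨g, hg, hx⟩ => ?_⟩
    have h1 : k ≤ m := by
      have := AddSubgroup.card_dvd_of_le ((hle g).1 hx)
      rw [hk, Nat.card_zmultiples, hg] at this
      exact (Nat.pow_dvd_pow_iff_le_right hp1).1 this
    obtain ⟨j, rfl⟩ := Nat.exists_eq_succ_of_ne_zero (show m ≠ 0 by omega)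
    have h2 : j ≤ k := by
      have := AddSubgroup.card_dvd_of_le
        ((AddSubgroup.zmultiples_le (H := μ.range)).2 (hmem g))
      rw [hk, Nat.card_zmultiples, hordp g j hg] at this
      exact (Nat.pow_dvd_pow_iff_le_right hp1).1 this
    omega

/-! ### The counting identity and duality of finite abelian groups -/

open Finset in
theorem sum_generatorCount {G : Type} [AddCommGroup G] [Finite G] {p : ℕ}
    [hp : Fact p.Prime] {N : ℕ} (hN : 1 ≤ N) (hG : Nat.card G = p ^ N)
    [Decidable (∀ g : G, p • g = 0)] :
    ∑ i ∈ range (N + 1), (-1 : ℚ) ^ i * (p : ℚ) ^ (i + 1).choose 2 * generatorCount p (N - i) G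
      = if ∀ g : G, p • g = 0 then (-1 : ℚ) ^ N * (p : ℚ) ^ N.choose 2 else 0 := by
  have hch : ∀ i : ℕ, (i + 1).choose 2 = i + i.choose 2 := fun i => by
    rw [Nat.choose_succ_succ' i 1, Nat.choose_one_right]
  split_ifs with h
  · obtain ⟨h0, h1, h2⟩ := generatorCount_of_elementary hG h
    obtain ⟨M, rfl⟩ := Nat.exists_eq_add_of_le' hN
    have h1' : (generatorCount p 1 G : ℚ) = (p : ℚ) ^ (M + 1) - 1 := by
      rw [eq_sub_iff_add_eq]
      exact_mod_cast h1
    rw [sum_range_succ, sum_range_succ, Finset.sum_eq_zero]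
    · rw [Nat.sub_self, h0, Nat.add_sub_cancel_left, h1', hch (M + 1), pow_add, pow_succ (-1 : ℚ) M]
      push_cast
      ring
    · intro i hi
      rw [h2 _ (by have := mem_range.1 hi; omega)]
      simp
  · obtain ⟨k, hkN, h1, h2⟩ := generatorCount_of_not_elementary hG h
    obtain ⟨M, rfl⟩ := Nat.exists_eq_add_of_le hkN
    rw [← Finset.sum_subset (s₁ := {M, M + 1})]
    · rw [sum_pair (by omega), show k + 1 + M - M = k + 1 by omega,
        show k + 1 + M - (M + 1) = k by omega, h1, show k + 1 + M - k = M + 1 by omega,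
        hch (M + 1), pow_add, pow_succ (-1 : ℚ) M]
      push_cast
      ring
    · intro i hi
      simp only [mem_insert, mem_singleton] at hi
      rw [mem_range]
      omega
    · intro i hi hi'
      simp only [mem_insert, mem_singleton] at hi'
      rw [mem_range] at hi
      rw [h2 _ (by omega) (by omega)]
      simp

theorem generatorCount_zero {G : Type} [AddCommGroup G] {p : ℕ} [Decidable (∀ g : G, p • g = 0)] :
    generatorCount p 0 G = if ∀ g : G, p • g = 0 then 1 else 0 := by
  unfold generatorCount
  have : ∀ g : G, (addOrderOf g = p ^ 0 ∧ ∀ x : G, p • x ∈ AddSubgroup.zmultiples g) ↔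
      g = 0 ∧ ∀ g : G, p • g = 0 := by
    intro g
    rw [pow_zero, AddMonoid.addOrderOf_eq_one_iff]
    refine and_congr_right ?_
    rintro rfl
    simp
  rw [Nat.card_congr (Equiv.subtypeEquivRight this)]
  split_ifs with h
  · simp [h]
  · simp [h]

open Finset in
/-- The counting identity behind the recursion of the Hecke operators: an alternating sum over the
cyclic subgroups of `G` with elementary abelian quotient. -/
theorem sum_pairCount {G : Type} [AddCommGroup G] [Finite G] {p : ℕ}
    [hp : Fact p.Prime] {N : ℕ} (hN : 1 ≤ N) (hG : Nat.card G = p ^ N)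
    [Decidable ((elementaryType p N).mem G)] :
    (1 - (p : ℚ)⁻¹ ^ N) * ((p : ℚ) ^ N.choose 2 * if (elementaryType p N).mem G then 1 else 0) =
      ∑ i ∈ range N, (-1 : ℚ) ^ (N - 1 - i) * (1 - (p : ℚ)⁻¹) *
        ((p : ℚ) ^ i.choose 2 * pairCount (elementaryType p i) (cyclicType p (N - i)) G) := by
  classical
  have hp0 : (p : ℚ) ≠ 0 := Nat.cast_ne_zero.2 hp.out.ne_zero
  have hch : ∀ i : ℕ, (i + 1).choose 2 = i + i.choose 2 := fun i => by
    rw [Nat.choose_succ_succ' i 1, Nat.choose_one_right]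
  have hmem : (elementaryType p N).mem G ↔ ∀ g : G, p • g = 0 :=
    ⟨fun h => h.1, fun h => ⟨h, hG⟩⟩
  have key : ∀ i ∈ range N, (-1 : ℚ) ^ (N - 1 - i) * (1 - (p : ℚ)⁻¹) *
      ((p : ℚ) ^ i.choose 2 * pairCount (elementaryType p i) (cyclicType p (N - i)) G) =
      - ((-1) ^ N * (p : ℚ)⁻¹ ^ N) *
        ((-1 : ℚ) ^ i * (p : ℚ) ^ (i + 1).choose 2 * generatorCount p (N - i) G) := by
    intro i hi
    have hi := mem_range.1 hi
    obtain ⟨m, rfl⟩ := Nat.exists_eq_add_of_lt hi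
    rw [← pairCount_mul_totient hG hi.le, show i + m + 1 - i = m + 1 by omega,
      show i + m + 1 - 1 - i = m by omega, Nat.totient_prime_pow_succ hp.out, hch]
    push_cast [Nat.cast_sub hp.out.one_lt.le]
    have : ((-1 : ℚ) ^ i) * (-1) ^ i = 1 := by rw [← mul_pow]; simp
    have h2 : ((p : ℚ) ^ i) * (p : ℚ)⁻¹ ^ i = 1 := by rw [← mul_pow]; simp [hp0]
    have h3 : ((p : ℚ) ^ m) * (p : ℚ)⁻¹ ^ m = 1 := by rw [← mul_pow]; simp [hp0]
    have h4 : (1 - (p : ℚ)⁻¹) = (p : ℚ)⁻¹ * (p - 1) := by field_simp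
    rw [h4, pow_add, pow_add, pow_add, pow_add, pow_one, pow_one, pow_add]
    set P := pairCount (elementaryType p i) (cyclicType p (m + 1)) G
    linear_combination (-(-1 : ℚ) ^ m * (p : ℚ)⁻¹ * (p - 1) * p ^ i.choose 2 * P) *
      ((p : ℚ) ^ m * (p : ℚ)⁻¹ ^ m * ((p : ℚ) ^ i * (p : ℚ)⁻¹ ^ i) * this +
        (p : ℚ) ^ m * (p : ℚ)⁻¹ ^ m * h2 + h3)
  rw [sum_congr rfl key, ← mul_sum]
  have hA := sum_generatorCount hN hG
  rw [sum_range_succ, Nat.sub_self, generatorCount_zero, hch] at hA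
  have h5 : ((-1 : ℚ) ^ N) * (-1) ^ N = 1 := by rw [← mul_pow]; simp
  have h6 : ((p : ℚ) ^ N) * (p : ℚ)⁻¹ ^ N = 1 := by rw [← mul_pow]; simp [hp0]
  rw [← eq_sub_iff_add_eq] at hA
  rw [hA]
  by_cases h : ∀ g : G, p • g = 0
  · rw [if_pos h, if_pos h, if_pos (hmem.2 h), pow_add]
    push_cast
    linear_combination ((p : ℚ)⁻¹ ^ N * p ^ N.choose 2 * (1 - (p : ℚ) ^ N)) * h5 -
      (p : ℚ) ^ N.choose 2 * h6
  · rw [if_neg h, if_neg h, if_neg (mt hmem.1 h)]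
    simp

/-- Duality of finite abelian groups: there is a permutation of the subgroups that exchanges a
subgroup with the quotient by it, up to isomorphism. -/
theorem exists_dual_subgroup_mul (G : Type) [CommGroup G] [Finite G] :
    ∃ τ : Subgroup G ≃ Subgroup G, ∀ H, Nonempty (τ H ≃* G ⧸ H) ∧ Nonempty (G ⧸ τ H ≃* H) := by
  obtain ⟨e⟩ := CommGroup.monoidHom_mulEquiv_of_hasEnoughRootsOfUnity G ℂ
  let D := CommGroup.subgroupOrderIsoSubgroupMonoidHom G ℂ
  refine ⟨(D.toEquiv.trans OrderDual.ofDual).trans e.mapSubgroup.toEquiv, fun H => ?_⟩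
  have hD : (D H).ofDual = (MonoidHom.domRestrictHom H ℂˣ).ker := rfl
  have hτ : ((D.toEquiv.trans OrderDual.ofDual).trans e.mapSubgroup.toEquiv) H =
    (D H).ofDual.map e.toMonoidHom := rfl
  rw [hτ, hD]
  constructor
  · have := CommGroup.monoidHom_mulEquiv_of_hasEnoughRootsOfUnity (G ⧸ H) ℂ
    exact ⟨((MonoidHom.domRestrictHom H ℂˣ).ker.equivMapOfInjective e.toMonoidHom
      e.injective).symm.trans ((MonoidHom.domRestrictHomKerEquiv ℂˣ H).trans this.some)⟩
  · have := CommGroup.monoidHom_mulEquiv_of_hasEnoughRootsOfUnity H ℂ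
    refine ⟨(QuotientGroup.congr (MonoidHom.domRestrictHom H ℂˣ).ker _ e rfl).symm.trans
      ((QuotientGroup.quotientKerEquivOfSurjective _
        (MonoidHom.domRestrict_surjective ℂ H)).trans this.some)⟩

/-- The additive form of `exists_dual_subgroup_mul`. -/
theorem exists_dual_subgroup (G : Type) [AddCommGroup G] [Finite G] :
    ∃ τ : AddSubgroup G ≃ AddSubgroup G,
      ∀ H, Nonempty (τ H ≃+ G ⧸ H) ∧ Nonempty (G ⧸ τ H ≃+ H) := by
  obtain ⟨τ, hτ⟩ := exists_dual_subgroup_mul (Multiplicative G)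
  let f : AddSubgroup G ≃ Subgroup (Multiplicative G) := AddSubgroup.toSubgroup.toEquiv
  have hf : ∀ H, Nonempty (f H ≃* Multiplicative H) := fun H => ⟨MulEquiv.refl _⟩
  have hq : ∀ H, Nonempty ((Multiplicative G ⧸ f H) ≃* Multiplicative (G ⧸ H)) := fun H => by
    let φ : Multiplicative G →* Multiplicative (G ⧸ H) :=
      AddMonoidHom.toMultiplicative (QuotientAddGroup.mk' H)
    have hφ : Function.Surjective φ := QuotientAddGroup.mk'_surjective H
    have hker : f H = φ.ker := by
      ext x
      exact (QuotientAddGroup.eq_zero_iff (N := H) x.toAdd).symm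
    exact ⟨(QuotientGroup.quotientMulEquivOfEq hker).trans
      (QuotientGroup.quotientKerEquivOfSurjective φ hφ)⟩
  refine ⟨(f.trans τ).trans f.symm, fun H => ?_⟩
  obtain ⟨⟨e1⟩, ⟨e2⟩⟩ := hτ (f H)
  obtain ⟨K, hK⟩ := f.surjective (τ (f H))
  have : ((f.trans τ).trans f.symm) H = K := by
    simp [← hK]
  rw [this]
  rw [← hK] at e1 e2
  exact ⟨⟨AddEquiv.toMultiplicative.symm ((hf K).some.symm.trans (e1.trans (hq H).some))⟩,
    ⟨AddEquiv.toMultiplicative.symm ((hq K).some.symm.trans (e2.trans (hf H).some))⟩⟩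

theorem pairCount_comm (Q R : FiniteGroupType) (G : Type) [AddCommGroup G] [Finite G] :
    pairCount Q R G = pairCount R Q G := by
  obtain ⟨τ, hτ⟩ := exists_dual_subgroup G
  refine Nat.card_congr (τ.subtypeEquiv fun H => ?_)
  obtain ⟨⟨e1⟩, ⟨e2⟩⟩ := hτ H
  exact ⟨fun h => ⟨R.of_equiv e2.symm h.2, Q.of_equiv e1.symm h.1⟩,
    fun h => ⟨Q.of_equiv e1 h.2, R.of_equiv e2 h.1⟩⟩

/-! ### Subgroups of finite index in `ℤⁿ` and integral matrices -/

section

open Matrix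

/-- The subgroup of `ℤⁿ` generated by the rows of an integral matrix. -/
def rowLat {n : ℕ} (M : Matrix (Fin n) (Fin n) ℤ) : AddSubgroup (Fin n → ℤ) :=
  M.vecMulLinear.toAddMonoidHom.range

theorem mem_rowLat {n : ℕ} {M : Matrix (Fin n) (Fin n) ℤ} {v : Fin n → ℤ} :
    v ∈ rowLat M ↔ ∃ x, x ᵥ* M = v := Iff.rfl

theorem rowLat_mul {n : ℕ} (N M : Matrix (Fin n) (Fin n) ℤ) :
    rowLat (N * M) = (rowLat N).map M.vecMulLinear.toAddMonoidHom := by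
  ext v
  simp only [AddSubgroup.mem_map, mem_rowLat]
  constructor
  · rintro ⟨x, rfl⟩
    exact ⟨x ᵥ* N, ⟨x, rfl⟩, vecMul_vecMul x N M⟩
  · rintro ⟨_, ⟨x, rfl⟩, rfl⟩
    exact ⟨x, (vecMul_vecMul x N M).symm⟩

theorem rowLat_eq_top {n : ℕ} {U : Matrix (Fin n) (Fin n) ℤ} (hU : IsUnit U.det) :
    rowLat U = ⊤ := by
  rw [eq_top_iff]
  intro v _
  exact mem_rowLat.2 ⟨v ᵥ* U⁻¹, by rw [vecMul_vecMul, nonsing_inv_mul _ hU, vecMul_one]⟩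

theorem rowLat_unit_mul {n : ℕ} {U : Matrix (Fin n) (Fin n) ℤ} (hU : IsUnit U.det)
    (M : Matrix (Fin n) (Fin n) ℤ) : rowLat (U * M) = rowLat M := by
  rw [rowLat_mul, rowLat_eq_top hU, rowLat, AddMonoidHom.range_eq_map]

theorem rowLat_submatrix {n : ℕ} (σ : Equiv.Perm (Fin n)) (M : Matrix (Fin n) (Fin n) ℤ) :
    rowLat (M.submatrix σ id) = rowLat M := by
  have key : ∀ x, x ᵥ* M = (x ∘ σ) ᵥ* M.submatrix σ id := by
    intro x
    ext j
    exact (Equiv.sum_comp σ fun i => x i * M i j).symm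
  ext v
  simp only [mem_rowLat, key]
  constructor
  · rintro ⟨x, rfl⟩
    exact ⟨x ∘ σ.symm, by rw [Function.comp_assoc, σ.symm_comp_self, Function.comp_id]⟩
  · rintro ⟨x, rfl⟩
    exact ⟨_, rfl⟩

theorem vecMul_injective_of_det_ne_zero {n : ℕ} {M : Matrix (Fin n) (Fin n) ℤ} (hM : M.det ≠ 0) :
    Function.Injective M.vecMulLinear.toAddMonoidHom := by
  intro v w h
  have h' : (v - w) ᵥ* M = 0 := by
    rw [sub_vecMul, sub_eq_zero]
    exact h
  exact sub_eq_zero.1 (eq_zero_of_vecMul_eq_zero hM h')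

theorem index_rowLat_ne_zero {n : ℕ} {M : Matrix (Fin n) (Fin n) ℤ} (hM : M.det ≠ 0) :
    (rowLat M).index ≠ 0 :=
  Int.addSubgroup_index_ne_zero_iff.2
    ⟨(AddMonoidHom.ofInjective (vecMul_injective_of_det_ne_zero hM)).symm⟩

/-- Smith normal form of a subgroup of finite index, without divisibility conditions. -/
theorem exists_smith {n : ℕ} {L : AddSubgroup (Fin n → ℤ)} (hL : L.index ≠ 0) :
    ∃ (a : Fin n → ℤ) (V : Matrix (Fin n) (Fin n) ℤ),
      IsUnit V.det ∧ (∀ i, a i ≠ 0) ∧ L = rowLat (diagonal a * V) := by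
  obtain ⟨e⟩ := Int.addSubgroup_index_ne_zero_iff.1 hL
  let N : Submodule ℤ (Fin n → ℤ) := AddSubgroup.toIntSubmodule L
  have hr : Module.finrank ℤ N = Module.finrank ℤ (Fin n → ℤ) :=
    LinearEquiv.finrank_eq (AddEquiv.toIntLinearEquiv e)
  obtain ⟨b, a, c, hc⟩ := Submodule.exists_smith_normal_form_of_rank_eq (Pi.basisFun ℤ (Fin n)) hr
  have hV : (of fun i => b i : Matrix (Fin n) (Fin n) ℤ) =
      ((Pi.basisFun ℤ (Fin n)).toMatrix b)ᵀ := by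
    ext i j
    simp [Module.Basis.toMatrix_apply]
  refine ⟨a, of fun i => b i, ?_, fun i hi => ?_, ?_⟩
  · rw [hV, det_transpose]
    have := (Pi.basisFun ℤ (Fin n)).invertibleToMatrix b
    exact isUnit_det_of_invertible _
  · apply c.ne_zero i
    apply Subtype.ext
    rw [hc, hi, zero_smul]
    rfl
  · have hrow : ∀ i, (diagonal a * of fun i => b i : Matrix (Fin n) (Fin n) ℤ) i =
        (c i : Fin n → ℤ) := by
      intro i
      ext j
      rw [diagonal_mul, hc]
      rfl
    ext v
    rw [mem_rowLat]
    constructor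
    · intro hv
      refine ⟨fun i => c.repr ⟨v, hv⟩ i, ?_⟩
      have hv' : v ∈ N := hv
      have : ∑ i, c.repr ⟨v, hv'⟩ i • (c i : Fin n → ℤ) = v := by
        simpa only [map_sum, map_smul, Submodule.subtype_apply] using
          congrArg N.subtype (c.sum_repr ⟨v, hv'⟩)
      rw [vecMul_eq_sum]
      simp only [hrow]
      exact this
    · rintro ⟨x, rfl⟩
      rw [vecMul_eq_sum]
      refine AddSubgroup.sum_mem _ fun i _ => ?_
      change x i • (diagonal a * of fun i => b i : Matrix (Fin n) (Fin n) ℤ) i ∈ L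
      rw [hrow]
      exact AddSubgroup.zsmul_mem _ (c i).2 _

/-- The reflection in the first coordinate. -/
def signFlip (n : ℕ) : Matrix (Fin n) (Fin n) ℤ :=
  diagonal fun i => if (i : ℕ) = 0 then -1 else 1

theorem det_signFlip {n : ℕ} (hn : 1 ≤ n) : (signFlip n).det = -1 := by
  obtain ⟨m, rfl⟩ := Nat.exists_eq_add_of_le' hn
  rw [signFlip, det_diagonal, Fin.prod_univ_succ]
  simp

theorem exists_rowLat_eq {n : ℕ} (hn : 1 ≤ n) {L : AddSubgroup (Fin n → ℤ)} (hL : L.index ≠ 0) :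
    ∃ M : Matrix (Fin n) (Fin n) ℤ, 0 < M.det ∧ rowLat M = L := by
  obtain ⟨a, V, hV, ha, rfl⟩ := exists_smith hL
  have hdet : (diagonal a * V).det ≠ 0 := by
    rw [det_mul, det_diagonal]
    exact mul_ne_zero (Finset.prod_ne_zero_iff.2 fun i _ => ha i) hV.ne_zero
  rcases lt_or_gt_of_ne hdet with h | h
  · refine ⟨signFlip n * (diagonal a * V), ?_, rowLat_unit_mul ?_ _⟩
    · rw [det_mul, det_signFlip hn]
      linarith
    · rw [det_signFlip hn]
      exact isUnit_one.neg
  · exact ⟨_, h, rfl⟩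

theorem exists_eq_mul_of_rowLat_le {n : ℕ} {A B : Matrix (Fin n) (Fin n) ℤ}
    (h : rowLat A ≤ rowLat B) : ∃ X, A = X * B := by
  have : ∀ i, ∃ x, x ᵥ* B = A i := fun i => mem_rowLat.1 (h (mem_rowLat.2
    ⟨Pi.single i 1, by rw [single_one_vecMul]; rfl⟩))
  choose X hX using this
  refine ⟨of X, ?_⟩
  ext i j
  rw [← hX i]
  rfl

theorem exists_specialLinear_of_rowLat_eq {n : ℕ} {A B : Matrix (Fin n) (Fin n) ℤ}
    (hA : 0 < A.det) (hB : 0 < B.det) (h : rowLat A = rowLat B) :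
    ∃ U : SpecialLinearGroup (Fin n) ℤ, A = U.1 * B := by
  obtain ⟨X, hX⟩ := exists_eq_mul_of_rowLat_le h.le
  obtain ⟨Y, hY⟩ := exists_eq_mul_of_rowLat_le h.ge
  have h1 : A.det = X.det * B.det := by rw [← det_mul, ← hX]
  have h2 : B.det = Y.det * A.det := by rw [← det_mul, ← hY]
  have h3 : X.det * Y.det = 1 := by
    have : X.det * Y.det * A.det = 1 * A.det := by rw [mul_assoc, ← h2, ← h1, one_mul]
    exact mul_right_cancel₀ hA.ne' this
  have h4 : 0 < X.det := by
    by_contra hneg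
    have := mul_nonpos_of_nonpos_of_nonneg (not_lt.1 hneg) hB.le
    omega
  have h5 : X.det = 1 := by
    rcases Int.isUnit_iff.1 (IsUnit.of_mul_eq_one _ h3) with h | h <;> omega
  exact ⟨⟨X, h5⟩, hX⟩

/-- A subgroup of index `c` contains `c ℤⁿ`, which has finite index. -/
theorem finite_setOf_index_eq (n : ℕ) {c : ℕ} (hc : c ≠ 0) :
    {K : AddSubgroup (Fin n → ℤ) | K.index = c}.Finite := by
  let μ : (Fin n → ℤ) →+ (Fin n → ℤ) := nsmulAddMonoidHom c
  have hμ : Function.Injective μ := fun v w h => by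
    have h' : c • v = c • w := h
    funext i
    have := congrFun h' i
    simpa [hc] using this
  have hD : μ.range.index ≠ 0 :=
    Int.addSubgroup_index_ne_zero_iff.2 ⟨(AddMonoidHom.ofInjective hμ).symm⟩
  have : Finite ((Fin n → ℤ) ⧸ μ.range) := by
    have : μ.range.FiniteIndex := ⟨hD⟩
    infer_instance
  refine Set.Finite.of_finite_image (f := fun K => K.map (QuotientAddGroup.mk' μ.range))
    (Set.toFinite _) ?_
  have key : ∀ K : AddSubgroup (Fin n → ℤ), K.index = c →
      (K.map (QuotientAddGroup.mk' μ.range)).comap (QuotientAddGroup.mk' μ.range) = K := by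
    intro K hK
    rw [AddSubgroup.comap_map_eq, QuotientAddGroup.ker_mk', sup_eq_left]
    rintro _ ⟨v, rfl⟩
    have := AddSubgroup.nsmul_index_mem K v
    rwa [hK] at this
  intro K hK L hL h
  rw [← key K hK, ← key L hL]
  exact congrArg _ h

/-- The matrix `diag(k, 1, …, 1)`. -/
def rowDiag (n k : ℕ) : Matrix (Fin n) (Fin n) ℤ :=
  diagonal fun i => if (i : ℕ) = 0 then (k : ℤ) else 1

theorem det_rowDiag {n : ℕ} (hn : 1 ≤ n) (k : ℕ) : (rowDiag n k).det = k := by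
  obtain ⟨m, rfl⟩ := Nat.exists_eq_add_of_le' hn
  rw [rowDiag, det_diagonal, Fin.prod_univ_succ]
  simp

/-- An automorphism `V` of `ℤⁿ` identifies `ℤⁿ / L` with `ℤⁿ / L V`. -/
def quotientMapEquiv {n : ℕ} {V : Matrix (Fin n) (Fin n) ℤ} (hV : IsUnit V.det)
    (L : AddSubgroup (Fin n → ℤ)) :
    ((Fin n → ℤ) ⧸ L) ≃+ ((Fin n → ℤ) ⧸ L.map V.vecMulLinear.toAddMonoidHom) :=
  QuotientAddGroup.congr _ _ (AddEquiv.ofBijective V.vecMulLinear.toAddMonoidHom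
    ⟨vecMul_injective_of_det_ne_zero hV.ne_zero,
      AddMonoidHom.range_eq_top.1 (rowLat_eq_top hV)⟩) rfl

theorem nonempty_quotient_rowDiag_equiv {n : ℕ} (hn : 1 ≤ n) (k : ℕ)
    {V : Matrix (Fin n) (Fin n) ℤ} (hV : IsUnit V.det) :
    Nonempty (((Fin n → ℤ) ⧸ rowLat (rowDiag n k * V)) ≃+ ZMod k) := by
  rw [rowLat_mul]
  refine ⟨(quotientMapEquiv hV _).symm.trans ?_⟩
  let φ : (Fin n → ℤ) →+ ZMod k :=
    (Int.castAddHom (ZMod k)).comp (Pi.evalAddMonoidHom (fun _ => ℤ) ⟨0, hn⟩)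
  have hφ : Function.Surjective φ := fun x =>
    ⟨fun _ => x.cast, by simp [φ]⟩
  have hker : rowLat (rowDiag n k) = φ.ker := by
    ext v
    rw [mem_rowLat, AddMonoidHom.mem_ker]
    change _ ↔ ((v ⟨0, hn⟩ : ℤ) : ZMod k) = 0
    rw [ZMod.intCast_zmod_eq_zero_iff_dvd]
    constructor
    · rintro ⟨x, rfl⟩
      rw [rowDiag, vecMul_diagonal]
      simp
    · rintro ⟨c, hc⟩
      refine ⟨fun i => if (i : ℕ) = 0 then c else v i, ?_⟩
      ext i
      rw [rowDiag, vecMul_diagonal]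
      by_cases hi : (i : ℕ) = 0
      · have : i = ⟨0, hn⟩ := Fin.ext hi
        rw [if_pos hi, if_pos hi, this, hc, mul_comm]
      · rw [if_neg hi, if_neg hi, mul_one]
  exact (QuotientAddGroup.quotientAddEquivOfEq hker).trans
    (QuotientAddGroup.quotientKerEquivOfSurjective φ hφ)

theorem not_isAddCyclic_prod_zmod (p : ℕ) [hp : Fact p.Prime] :
    ¬ IsAddCyclic (ZMod p × ZMod p) := by
  intro h
  obtain ⟨g, hg⟩ := h.exists_ofOrder_eq_natCard
  have h1 : addOrderOf g ∣ p := addOrderOf_dvd_of_nsmul_eq_zero (by ext <;> simp)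
  rw [hg, Nat.card_prod, Nat.card_zmod] at h1
  have := Nat.le_of_dvd hp.out.pos h1
  nlinarith [hp.out.one_lt]

/-- If `ℤⁿ / L` is cyclic of order `p ^ m`, then at most one elementary divisor of `L` is not a
unit. -/
theorem exists_forall_isUnit {n : ℕ} (hn : 1 ≤ n) {p m : ℕ} [hp : Fact p.Prime]
    {a : Fin n → ℤ} {V : Matrix (Fin n) (Fin n) ℤ} (hV : IsUnit V.det)
    (h : (cyclicType p m).mem ((Fin n → ℤ) ⧸ rowLat (diagonal a * V))) :
    ∃ i, ∀ j, j ≠ i → IsUnit (a j) := by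
  have hcoord : ∀ v ∈ rowLat (diagonal a * V), ∀ i, a i ∣ (v ᵥ* V⁻¹) i := by
    intro v hv i
    obtain ⟨x, rfl⟩ := mem_rowLat.1 hv
    rw [vecMul_vecMul, Matrix.mul_assoc, mul_nonsing_inv _ hV, Matrix.mul_one, vecMul_diagonal]
    exact dvd_mul_left _ _
  have hdvd : ∀ i, ¬ IsUnit (a i) → (p : ℤ) ∣ a i := by
    intro i hi
    have h1 : p ^ m • (Pi.single i 1 ᵥ* V) ∈ rowLat (diagonal a * V) := by
      have := AddSubgroup.nsmul_index_mem (rowLat (diagonal a * V)) (Pi.single i 1 ᵥ* V)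
      rwa [show (rowLat (diagonal a * V)).index = p ^ m from h.2] at this
    have h2 := hcoord _ h1 i
    rw [← Nat.cast_smul_eq_nsmul ℤ, smul_vecMul, vecMul_vecMul, mul_nonsing_inv _ hV,
      vecMul_one] at h2
    simp only [Pi.smul_apply, Pi.single_eq_same, smul_eq_mul, mul_one] at h2
    push_cast at h2
    obtain ⟨j, -, hj⟩ := (dvd_prime_pow (Nat.prime_iff_prime_int.1 hp.out) m).1 h2
    rcases Nat.eq_zero_or_pos j with rfl | hj0
    · rw [pow_zero] at hj
      exact absurd (hj.isUnit_iff.2 isUnit_one) hi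
    · exact (dvd_pow_self _ hj0.ne').trans hj.symm.dvd
  by_contra! hcon
  obtain ⟨i, -, hi⟩ := hcon ⟨0, hn⟩
  obtain ⟨j, hji, hj⟩ := hcon i
  let φ : (Fin n → ℤ) →+ ZMod p × ZMod p :=
    (((Int.castAddHom (ZMod p)).comp (Pi.evalAddMonoidHom (fun _ => ℤ) i)).prod
      ((Int.castAddHom (ZMod p)).comp (Pi.evalAddMonoidHom (fun _ => ℤ) j))).comp
      V⁻¹.vecMulLinear.toAddMonoidHom
  have hφ' : ∀ v, φ v = (((v ᵥ* V⁻¹) i : ZMod p), ((v ᵥ* V⁻¹) j : ZMod p)) := fun _ => rfl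
  have hφ : Function.Surjective φ := by
    rintro ⟨x, y⟩
    refine ⟨(Pi.single i x.cast + Pi.single j y.cast) ᵥ* V, ?_⟩
    rw [hφ', vecMul_vecMul, mul_nonsing_inv _ hV, vecMul_one]
    simp [hji, hji.symm]
  have hle : rowLat (diagonal a * V) ≤ φ.ker := by
    intro v hv
    rw [AddMonoidHom.mem_ker, hφ', (ZMod.intCast_zmod_eq_zero_iff_dvd _ p).2
      ((hdvd i hi).trans (hcoord v hv i)), (ZMod.intCast_zmod_eq_zero_iff_dvd _ p).2
      ((hdvd j hj).trans (hcoord v hv j))]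
    rfl
  have := h.1
  refine not_isAddCyclic_prod_zmod p (isAddCyclic_of_surjective (QuotientAddGroup.lift _ φ hle) ?_)
  intro x
  obtain ⟨v, rfl⟩ := hφ x
  exact ⟨(v : (Fin n → ℤ) ⧸ rowLat (diagonal a * V)), rfl⟩

/-- A subgroup of `ℤⁿ` with cyclic quotient of order `p ^ m` is spanned by the rows of
`diag(p ^ m, 1, …, 1) V` for some `V ∈ SL_n(ℤ)`. -/
theorem exists_rowLat_rowDiag_eq {n : ℕ} (hn : 1 ≤ n) {p m : ℕ} [hp : Fact p.Prime]
    {L : AddSubgroup (Fin n → ℤ)} (h : (cyclicType p m).mem ((Fin n → ℤ) ⧸ L)) :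
    ∃ V : SpecialLinearGroup (Fin n) ℤ, rowLat (rowDiag n (p ^ m) * V.1) = L := by
  have hL : L.index ≠ 0 := by
    rw [show L.index = p ^ m from h.2]
    exact pow_ne_zero _ hp.out.ne_zero
  obtain ⟨a, V₀, hV₀, -, rfl⟩ := exists_smith hL
  obtain ⟨i, hi⟩ := exists_forall_isUnit hn hV₀ h
  let o : Fin n := ⟨0, hn⟩
  let σ : Equiv.Perm (Fin n) := Equiv.swap o i
  let ε : Fin n → ℤ := fun j => if j = o then (if 0 ≤ a i then 1 else -1) else a (σ j)
  have hε : ∀ j, IsUnit (ε j) := by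
    intro j
    by_cases hj : j = o
    · simp only [ε, if_pos hj]
      split_ifs
      · exact isUnit_one
      · exact isUnit_one.neg
    · simp only [ε, if_neg hj]
      refine hi _ fun hji => hj ?_
      rw [← σ.injective.eq_iff, hji]
      simp [σ]
  have haε : ∀ j : Fin n, a (σ j) = (if (j : ℕ) = 0 then ((a i).natAbs : ℤ) else 1) * ε j := by
    intro j
    by_cases hj : j = o
    · have : (j : ℕ) = 0 := by rw [hj]
      rw [if_pos this]
      simp only [ε, if_pos hj]
      rw [hj, show σ o = i from Equiv.swap_apply_left _ _]
      split_ifs with h0 <;> omega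
    · have : (j : ℕ) ≠ 0 := fun h' => hj (Fin.ext h')
      rw [if_neg this, one_mul]
      simp only [ε, if_neg hj]
  let V₁ := diagonal ε * V₀.submatrix σ id
  have hV₁ : IsUnit V₁.det := by
    rw [det_mul, det_diagonal]
    refine IsUnit.mul (by rw [IsUnit.prod_univ_iff]; exact hε) ?_
    rw [det_permute]
    exact IsUnit.mul (by
      rcases Int.units_eq_one_or (Equiv.Perm.sign σ) with h | h <;> simp [h]) hV₀
  have hrow : rowLat (diagonal a * V₀) = rowLat (rowDiag n (a i).natAbs * V₁) := by
    rw [← rowLat_submatrix σ, ← Matrix.mul_assoc, rowDiag, diagonal_mul_diagonal]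
    congr 1
    ext j k
    rw [submatrix_apply, diagonal_mul, diagonal_mul, haε]
    rfl
  have hk : (a i).natAbs = p ^ m := by
    obtain ⟨e⟩ := nonempty_quotient_rowDiag_equiv hn (a i).natAbs hV₁
    rw [← h.2, hrow, Nat.card_congr e.toEquiv, Nat.card_zmod]
  rw [hk] at hrow
  rcases Int.isUnit_iff.1 hV₁ with h1 | h1
  · exact ⟨⟨V₁, h1⟩, hrow.symm⟩
  · refine ⟨⟨signFlip n * V₁, by rw [det_mul, det_signFlip hn, h1]; rfl⟩, ?_⟩
    have hcomm : rowDiag n (p ^ m) * signFlip n = signFlip n * rowDiag n (p ^ m) := by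
      simp only [rowDiag, signFlip, diagonal_mul_diagonal, mul_comm]
    rw [← Matrix.mul_assoc (rowDiag n (p ^ m)), hcomm, Matrix.mul_assoc (signFlip n), hrow]
    exact rowLat_unit_mul (by rw [det_signFlip hn]; exact isUnit_one.neg) _

end

/-! ### Operators that sum over subgroups with prescribed quotient -/

section

open Matrix

/-- An integral matrix with nonzero determinant as an element of `GL_n(ℝ)`; the value is `1` if the
determinant vanishes. -/
def realGL {n : ℕ} (M : Matrix (Fin n) (Fin n) ℤ) : GL (Fin n) ℝ :=
  if h : (M.map (Int.cast : ℤ → ℝ)).det ≠ 0 then GeneralLinearGroup.mkOfDetNeZero _ h else 1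

theorem coe_realGL {n : ℕ} {M : Matrix (Fin n) (Fin n) ℤ} (h : M.det ≠ 0) :
    (realGL M : Matrix (Fin n) (Fin n) ℝ) = M.map (Int.cast : ℤ → ℝ) := by
  have h' : (M.map (Int.cast : ℤ → ℝ)).det ≠ 0 := by
    rw [← Int.cast_det]
    exact_mod_cast h
  rw [realGL, dif_pos h']
  rfl

theorem realGL_mul {n : ℕ} {N M : Matrix (Fin n) (Fin n) ℤ} (hN : N.det ≠ 0) (hM : M.det ≠ 0) :
    realGL (N * M) = realGL N * realGL M := by
  apply Units.ext
  rw [Units.val_mul, coe_realGL hN, coe_realGL hM, coe_realGL, Matrix.map_mul_intCast]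
  rw [det_mul]
  exact mul_ne_zero hN hM

theorem realGL_specialLinear {n : ℕ} (U : SpecialLinearGroup (Fin n) ℤ) :
    realGL U.1 = SpecialLinearGroup.mapGL ℝ U := by
  apply Units.ext
  rw [coe_realGL (by rw [U.2]; exact one_ne_zero)]
  rfl

theorem realGL_specialLinear_mem {n : ℕ} (U : SpecialLinearGroup (Fin n) ℤ) :
    realGL U.1 ∈ gammaGL n := ⟨U, (realGL_specialLinear U).symm⟩

open Classical in
/-- A matrix of positive determinant whose rows span `L`; the value is `1` if there is none. For
`n ≥ 1` there is one if and only if `L` has finite index in `ℤⁿ`. -/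
def latMatrix {n : ℕ} (L : AddSubgroup (Fin n → ℤ)) : Matrix (Fin n) (Fin n) ℤ :=
  if h : ∃ M : Matrix (Fin n) (Fin n) ℤ, 0 < M.det ∧ rowLat M = L then h.choose else 1

theorem latMatrix_spec {n : ℕ} (hn : 1 ≤ n) {L : AddSubgroup (Fin n → ℤ)} (hL : L.index ≠ 0) :
    0 < (latMatrix L).det ∧ rowLat (latMatrix L) = L := by
  have h := exists_rowLat_eq hn hL
  rw [latMatrix, dif_pos h]
  exact h.choose_spec

/-- The value at `L` of the function on the subgroups of `ℤⁿ` that `F` and the point `z` define: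
`F(M z)`, where the rows of `M` span `L` and `det M > 0`. -/
def latValue {n : ℕ} (F : LocSym n → ℂ) (z : UpperHalf n) (L : AddSubgroup (Fin n → ℤ)) : ℂ :=
  F (LocSym.mk (ProjGenLinGroup.mk (realGL (latMatrix L)) • z))

theorem mk_realGL_smul_eq {n : ℕ} {A B : Matrix (Fin n) (Fin n) ℤ} (hA : 0 < A.det)
    (hB : 0 < B.det) (h : rowLat A = rowLat B) (z : UpperHalf n) :
    LocSym.mk (ProjGenLinGroup.mk (realGL A) • z) =
      LocSym.mk (ProjGenLinGroup.mk (realGL B) • z) := by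
  obtain ⟨U, rfl⟩ := exists_specialLinear_of_rowLat_eq hA hB h
  rw [realGL_mul (by rw [U.2]; exact one_ne_zero) hB.ne', map_mul, mul_smul,
    LocSym.mk_smul (realGL_specialLinear_mem U)]

theorem latValue_rowLat {n : ℕ} (hn : 1 ≤ n) (F : LocSym n → ℂ) (z : UpperHalf n)
    {M : Matrix (Fin n) (Fin n) ℤ} (hM : 0 < M.det) :
    latValue F z (rowLat M) = F (LocSym.mk (ProjGenLinGroup.mk (realGL M) • z)) := by
  obtain ⟨h1, h2⟩ := latMatrix_spec hn (index_rowLat_ne_zero hM.ne')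
  exact congrArg F (mk_realGL_smul_eq h1 hM h2 z)

theorem latValue_smul {n : ℕ} (hn : 1 ≤ n) (F : LocSym n → ℂ) (z : UpperHalf n)
    {M : Matrix (Fin n) (Fin n) ℤ} (hM : 0 < M.det) {L : AddSubgroup (Fin n → ℤ)}
    (hL : L.index ≠ 0) :
    latValue F (ProjGenLinGroup.mk (realGL M) • z) L =
      latValue F z (L.map M.vecMulLinear.toAddMonoidHom) := by
  obtain ⟨h1, h2⟩ := latMatrix_spec hn hL
  conv_rhs => rw [← h2]
  rw [← rowLat_mul, latValue_rowLat hn F z (by rw [det_mul]; exact mul_pos h1 hM),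
    realGL_mul h1.ne' hM.ne', map_mul, mul_smul]
  rfl

/-- The subgroups of `ℤⁿ` whose quotient is in the class `Q`. -/
def typeFinset (n : ℕ) (Q : FiniteGroupType) : Finset (AddSubgroup (Fin n → ℤ)) :=
  ((finite_setOf_index_eq n Q.order_ne_zero).subset
    fun K (h : K ∈ {K | Q.mem ((Fin n → ℤ) ⧸ K)}) => Q.card_eq h).toFinset

theorem mem_typeFinset {n : ℕ} {Q : FiniteGroupType} {K : AddSubgroup (Fin n → ℤ)} :
    K ∈ typeFinset n Q ↔ Q.mem ((Fin n → ℤ) ⧸ K) := by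
  rw [typeFinset, Set.Finite.mem_toFinset]
  rfl

theorem index_of_mem_typeFinset {n : ℕ} {Q : FiniteGroupType} {K : AddSubgroup (Fin n → ℤ)}
    (hK : K ∈ typeFinset n Q) : K.index = Q.order := Q.card_eq (mem_typeFinset.1 hK)

theorem index_ne_zero_of_mem_typeFinset {n : ℕ} {Q : FiniteGroupType}
    {K : AddSubgroup (Fin n → ℤ)} (hK : K ∈ typeFinset n Q) : K.index ≠ 0 :=
  index_of_mem_typeFinset hK ▸ Q.order_ne_zero

/-- An element of `Γ` permutes the subgroups of `ℤⁿ` and preserves their quotients. -/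
theorem sum_latValue_smul {n : ℕ} (hn : 1 ≤ n) (Q : FiniteGroupType) (F : LocSym n → ℂ)
    {g : GL (Fin n) ℝ} (hg : g ∈ gammaGL n) (z : UpperHalf n) :
    ∑ L ∈ typeFinset n Q, latValue F (ProjGenLinGroup.mk g • z) L =
      ∑ L ∈ typeFinset n Q, latValue F z L := by
  obtain ⟨U, rfl⟩ := hg
  have hdet : U.1.det = 1 := U.2
  have hU : IsUnit U.1.det := by rw [hdet]; exact isUnit_one
  have hmem : ∀ L, L ∈ typeFinset n Q ↔
      L.map U.1.vecMulLinear.toAddMonoidHom ∈ typeFinset n Q := fun L => by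
    rw [mem_typeFinset, mem_typeFinset]
    exact ⟨Q.of_equiv (quotientMapEquiv hU L), Q.of_equiv (quotientMapEquiv hU L).symm⟩
  have hinj := vecMul_injective_of_det_ne_zero hU.ne_zero
  rw [← realGL_specialLinear]
  refine Finset.sum_bij (fun L _ => L.map U.1.vecMulLinear.toAddMonoidHom)
    (fun L hL => (hmem L).1 hL) (fun L _ L' _ h => AddSubgroup.map_injective hinj h)
    (fun L hL => ?_)
    (fun L hL => latValue_smul hn F z (by rw [hdet]; exact one_pos)
      (index_ne_zero_of_mem_typeFinset hL))
  have hL' : (L.comap U.1.vecMulLinear.toAddMonoidHom).map U.1.vecMulLinear.toAddMonoidHom = L := by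
    apply AddSubgroup.map_comap_eq_self
    have : U.1.vecMulLinear.toAddMonoidHom.range = ⊤ := rowLat_eq_top hU
    rw [this]
    exact le_top
  exact ⟨_, (hmem _).2 (hL'.symm ▸ hL), hL'⟩

/-- The operator that sums over the subgroups of `ℤⁿ` whose quotient is in the class `Q`. -/
def latOp {n : ℕ} (hn : 1 ≤ n) (Q : FiniteGroupType) : Module.End ℂ (LocSym n → ℂ) where
  toFun F := Quotient.lift (fun z => ∑ L ∈ typeFinset n Q, latValue F z L) (by
    rintro z w ⟨⟨_, g, hg, rfl⟩, rfl⟩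
    exact sum_latValue_smul hn Q F hg w)
  map_add' F G := by
    funext x
    induction x using Quotient.inductionOn with
    | h z => exact Finset.sum_add_distrib
  map_smul' c F := by
    funext x
    induction x using Quotient.inductionOn with
    | h z => exact (Finset.mul_sum _ _ _).symm

theorem latOp_apply_mk {n : ℕ} (hn : 1 ≤ n) (Q : FiniteGroupType) (F : LocSym n → ℂ)
    (z : UpperHalf n) : latOp hn Q F (LocSym.mk z) = ∑ L ∈ typeFinset n Q, latValue F z L := rfl

/-- The subgroups of `ℤⁿ` of index `c`; none for `c = 0`. -/
def indexFinset (n c : ℕ) : Finset (AddSubgroup (Fin n → ℤ)) :=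
  if hc : c ≠ 0 then (finite_setOf_index_eq n hc).toFinset else ∅

theorem mem_indexFinset {n c : ℕ} (hc : c ≠ 0) {K : AddSubgroup (Fin n → ℤ)} :
    K ∈ indexFinset n c ↔ K.index = c := by
  rw [indexFinset, dif_pos hc, Set.Finite.mem_toFinset]
  rfl

open Classical in
theorem latOp_apply_eq_sum_indexFinset {n : ℕ} (hn : 1 ≤ n) (Q : FiniteGroupType)
    (F : LocSym n → ℂ) (z : UpperHalf n) :
    latOp hn Q F (LocSym.mk z) = ∑ K ∈ indexFinset n Q.order,
      ((if Q.mem ((Fin n → ℤ) ⧸ K) then 1 else 0 : ℚ) : ℂ) * latValue F z K := by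
  have : typeFinset n Q = (indexFinset n Q.order).filter fun K => Q.mem ((Fin n → ℤ) ⧸ K) := by
    ext K
    rw [Finset.mem_filter, mem_indexFinset Q.order_ne_zero, mem_typeFinset]
    exact ⟨fun h => ⟨Q.card_eq h, h⟩, fun h => h.2⟩
  rw [latOp_apply_mk, this, Finset.sum_filter]
  refine Finset.sum_congr rfl fun K _ => ?_
  split_ifs <;> simp

/-- If `M` has nonzero determinant and its rows span `L`, then `v ↦ v M` identifies `ℤⁿ / K` with
`L / K M`. -/
def quotientAddSubgroupOfEquiv {n : ℕ} {M : Matrix (Fin n) (Fin n) ℤ} (hM : M.det ≠ 0)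
    (K : AddSubgroup (Fin n → ℤ)) :
    ((Fin n → ℤ) ⧸ K) ≃+
      (rowLat M ⧸ (K.map M.vecMulLinear.toAddMonoidHom).addSubgroupOf (rowLat M)) :=
  QuotientAddGroup.congr _ _ (AddMonoidHom.ofInjective (vecMul_injective_of_det_ne_zero hM)) (by
    ext ⟨v, hv⟩
    rw [AddSubgroup.mem_addSubgroupOf]
    constructor
    · rintro ⟨x, hx, h⟩
      exact ⟨x, hx, congrArg Subtype.val h⟩
    · rintro ⟨x, hx, h⟩
      exact ⟨x, hx, Subtype.ext h⟩)

open Classical in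
/-- The subgroups `K M` of `L = rowLat M`, for `K` with quotient in `R`, are the subgroups of `L`
with quotient in `R`. -/
theorem sum_typeFinset_map {n : ℕ} {M : Matrix (Fin n) (Fin n) ℤ} (hM : M.det ≠ 0)
    (R : FiniteGroupType) (g : AddSubgroup (Fin n → ℤ) → ℂ) :
    ∑ K ∈ typeFinset n R, g (K.map M.vecMulLinear.toAddMonoidHom) =
      ∑ K ∈ indexFinset n ((rowLat M).index * R.order),
        if K ≤ rowLat M ∧ R.mem (rowLat M ⧸ K.addSubgroupOf (rowLat M)) then g K else 0 := by
  have hinj := vecMul_injective_of_det_ne_zero hM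
  rw [← Finset.sum_filter]
  refine Finset.sum_bij (fun K _ => K.map M.vecMulLinear.toAddMonoidHom) (fun K hK => ?_)
    (fun L _ L' _ h => AddSubgroup.map_injective hinj h) (fun K hK => ?_) fun _ _ => rfl
  · rw [Finset.mem_filter, mem_indexFinset (mul_ne_zero (index_rowLat_ne_zero hM) R.order_ne_zero)]
    refine ⟨?_, ?_, R.of_equiv (quotientAddSubgroupOfEquiv hM K) (mem_typeFinset.1 hK)⟩
    · rw [AddSubgroup.index_map_of_injective _ hinj, index_of_mem_typeFinset hK, mul_comm]
      rfl
    · rintro _ ⟨x, -, rfl⟩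
      exact ⟨x, rfl⟩
  · obtain ⟨-, hle, hR⟩ := Finset.mem_filter.1 hK
    have hmap : (K.comap M.vecMulLinear.toAddMonoidHom).map M.vecMulLinear.toAddMonoidHom = K :=
      AddSubgroup.map_comap_eq_self hle
    refine ⟨_, mem_typeFinset.2 (R.of_equiv (quotientAddSubgroupOfEquiv hM _).symm ?_), hmap⟩
    rw [hmap]
    exact hR

open Classical in
/-- Subgroups of `ℤⁿ / K` correspond to the subgroups of `ℤⁿ` between `K` and `ℤⁿ`. -/
theorem card_filter_eq_pairCount {n : ℕ} (Q R : FiniteGroupType) (K : AddSubgroup (Fin n → ℤ)) :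
    ((typeFinset n Q).filter fun L => K ≤ L ∧ R.mem (L ⧸ K.addSubgroupOf L)).card =
      pairCount Q R ((Fin n → ℤ) ⧸ K) := by
  let π := QuotientAddGroup.mk' K
  have hπ : Function.Surjective π := QuotientAddGroup.mk'_surjective K
  have hQ : ∀ H : AddSubgroup ((Fin n → ℤ) ⧸ K),
      Nonempty (((Fin n → ℤ) ⧸ H.comap π) ≃+ (((Fin n → ℤ) ⧸ K) ⧸ H)) := fun H => by
    let φ := (QuotientAddGroup.mk' H).comp π
    have hφ : Function.Surjective φ := (QuotientAddGroup.mk'_surjective H).comp hπ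
    have hk : H.comap π = φ.ker := by
      ext v
      exact (QuotientAddGroup.eq_zero_iff (N := H) (π v)).symm
    exact ⟨(QuotientAddGroup.quotientAddEquivOfEq hk).trans
      (QuotientAddGroup.quotientKerEquivOfSurjective φ hφ)⟩
  have hR : ∀ H : AddSubgroup ((Fin n → ℤ) ⧸ K),
      Nonempty ((H.comap π ⧸ K.addSubgroupOf (H.comap π)) ≃+ H) := fun H => by
    let φ : H.comap π →+ H := (π.comp (H.comap π).subtype).codRestrict H fun x => x.2
    have hφ : Function.Surjective φ := by
      rintro ⟨y, hy⟩
      obtain ⟨x, rfl⟩ := hπ y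
      exact ⟨⟨x, hy⟩, rfl⟩
    have hk : K.addSubgroupOf (H.comap π) = φ.ker := by
      ext v
      rw [AddSubgroup.mem_addSubgroupOf, AddMonoidHom.mem_ker, ← QuotientAddGroup.eq_zero_iff]
      exact ⟨fun h => Subtype.ext h, fun h => congrArg Subtype.val h⟩
    exact ⟨(QuotientAddGroup.quotientAddEquivOfEq hk).trans
      (QuotientAddGroup.quotientKerEquivOfSurjective φ hφ)⟩
  rw [← Fintype.card_coe, ← Nat.card_eq_fintype_card, pairCount]
  symm
  refine Nat.card_congr (Equiv.ofBijective (fun H => ⟨H.1.comap π, ?_⟩) ⟨?_, ?_⟩)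
  · rw [Finset.mem_filter, mem_typeFinset]
    refine ⟨Q.of_equiv (hQ H.1).some.symm H.2.1, ?_, R.of_equiv (hR H.1).some.symm H.2.2⟩
    intro v hv
    change π v ∈ H.1
    rw [show π v = 0 from (QuotientAddGroup.eq_zero_iff _).2 hv]
    exact H.1.zero_mem
  · intro H H' h
    exact Subtype.ext (AddSubgroup.comap_injective hπ (congrArg Subtype.val h))
  · rintro ⟨L, hL⟩
    rw [Finset.mem_filter, mem_typeFinset] at hL
    have hc : (L.map π).comap π = L := by
      rw [AddSubgroup.comap_map_eq, QuotientAddGroup.ker_mk', sup_eq_left]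
      exact hL.2.1
    refine ⟨⟨L.map π, Q.of_equiv (hQ _).some ?_, R.of_equiv (hR _).some ?_⟩, Subtype.ext hc⟩
    · rw [hc]
      exact hL.1
    · rw [hc]
      exact hL.2.2

/-- The product of two operators counts the intermediate subgroups. -/
theorem latOp_mul_apply {n : ℕ} (hn : 1 ≤ n) (Q R : FiniteGroupType) (F : LocSym n → ℂ)
    (z : UpperHalf n) :
    (latOp hn Q * latOp hn R) F (LocSym.mk z) = ∑ K ∈ indexFinset n (Q.order * R.order),
      (pairCount Q R ((Fin n → ℤ) ⧸ K) : ℂ) * latValue F z K := by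
  classical
  rw [Module.End.mul_apply, latOp_apply_mk]
  have h1 : ∀ L ∈ typeFinset n Q, latValue (latOp hn R F) z L =
      ∑ K ∈ indexFinset n (Q.order * R.order),
        if K ≤ L ∧ R.mem (L ⧸ K.addSubgroupOf L) then latValue F z K else 0 := by
    intro L hL
    obtain ⟨hd, hM⟩ := latMatrix_spec hn (index_ne_zero_of_mem_typeFinset hL)
    rw [latValue, latOp_apply_mk, Finset.sum_congr rfl fun K hK =>
      latValue_smul hn F z hd (index_ne_zero_of_mem_typeFinset hK),
      sum_typeFinset_map hd.ne' R (latValue F z), hM, index_of_mem_typeFinset hL]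
  rw [Finset.sum_congr rfl h1, Finset.sum_comm]
  refine Finset.sum_congr rfl fun K _ => ?_
  rw [← Finset.sum_filter, Finset.sum_const, card_filter_eq_pairCount, nsmul_eq_mul]

theorem latOp_commute {n : ℕ} (hn : 1 ≤ n) (Q R : FiniteGroupType) :
    latOp hn Q * latOp hn R = latOp hn R * latOp hn Q := by
  ext F x
  induction x using Quotient.inductionOn with
  | h z =>
    change (latOp hn Q * latOp hn R) F (LocSym.mk z) = (latOp hn R * latOp hn Q) F (LocSym.mk z)
    rw [latOp_mul_apply, latOp_mul_apply, mul_comm R.order]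
    refine Finset.sum_congr rfl fun K hK => ?_
    have hc := mul_ne_zero Q.order_ne_zero R.order_ne_zero
    have : K.FiniteIndex := ⟨by rw [(mem_indexFinset hc).1 hK]; exact hc⟩
    have : Finite ((Fin n → ℤ) ⧸ K) := inferInstance
    rw [pairCount_comm]

end

/-! ### One-row Hecke operators and the recursion -/

section

open Matrix

theorem diagPow_rowTuple {n : ℕ} (hn : 1 ≤ n) (p : Nat.Primes) (m : ℕ) :
    diagPow p (rowTuple n m) = realGL (rowDiag n ((p : ℕ) ^ m)) := by
  apply Units.ext
  rw [coe_realGL, rowDiag, diagonal_map (by simp)]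
  · change diagonal _ = diagonal _
    congr 1
    funext i
    rw [rowTuple]
    split_ifs <;> simp
  · rw [det_rowDiag hn]
    exact_mod_cast pow_ne_zero _ p.2.ne_zero

/-- The cosets in `Γ diag(p ^ m, 1, …, 1) Γ` are those of the bases of the subgroups of `ℤⁿ` with
cyclic quotient of order `p ^ m`. -/
theorem heckeRow_eq_latOp {n : ℕ} (hn : 1 ≤ n) (p : Nat.Primes) (m : ℕ) :
    heckeRow n p m = latOp hn (cyclicType p m) := by
  have hdet : (rowDiag n ((p : ℕ) ^ m)).det ≠ 0 := by
    rw [det_rowDiag hn]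
    exact_mod_cast pow_ne_zero _ p.2.ne_zero
  have hdet' : 0 < (rowDiag n ((p : ℕ) ^ m)).det := by
    rw [det_rowDiag hn]
    exact_mod_cast pow_pos p.2.pos _
  have hU : ∀ U : SpecialLinearGroup (Fin n) ℤ, IsUnit U.1.det := fun U => by
    rw [U.2]; exact isUnit_one
  -- two matrices with the same row lattice give the same coset
  have hcos : ∀ {A B : Matrix (Fin n) (Fin n) ℤ}, 0 < A.det → 0 < B.det → rowLat A = rowLat B →
      (Quotient.mk _ (realGL A) : CosetSpace n) = Quotient.mk _ (realGL B) := by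
    intro A B hA hB h
    obtain ⟨U, rfl⟩ := exists_specialLinear_of_rowLat_eq hA hB h
    refine Quotient.sound (QuotientGroup.rightRel_apply.2 ?_)
    rw [realGL_mul (hU U).ne_zero hB.ne', _root_.mul_inv_rev, mul_inv_cancel_left]
    exact (gammaGL n).inv_mem (realGL_specialLinear_mem U)
  ext F x
  induction x using Quotient.inductionOn with
  | h z =>
    change cosetSum (diagPow p (rowTuple n m)) F z = latOp hn (cyclicType p m) F (LocSym.mk z)
    rw [latOp_apply_mk, cosetSum, ← finsum_mem_coe_finset, diagPow_rowTuple hn]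
    symm
    refine finsum_mem_eq_of_bijOn
      (fun L => (Quotient.mk _ (realGL (latMatrix L)) : CosetSpace n)) ⟨?_, ?_, ?_⟩
      (fun L _ => rfl)
    · intro L hL
      rw [Finset.mem_coe] at hL
      obtain ⟨h1, h2⟩ := latMatrix_spec hn (index_ne_zero_of_mem_typeFinset hL)
      obtain ⟨V, hV⟩ := exists_rowLat_rowDiag_eq hn (mem_typeFinset.1 hL)
      refine ⟨realGL (rowDiag n ((p : ℕ) ^ m) * V.1), DoubleCoset.mem_doubleCoset.2
        ⟨1, (gammaGL n).one_mem, realGL V.1, realGL_specialLinear_mem V, ?_⟩,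
        hcos ?_ h1 (hV.trans h2.symm)⟩
      · rw [one_mul, realGL_mul hdet (hU V).ne_zero]
      · rw [det_mul, V.2, mul_one]
        exact hdet'
    · intro L hL L' hL' h
      rw [Finset.mem_coe] at hL hL'
      obtain ⟨h1, h2⟩ := latMatrix_spec hn (index_ne_zero_of_mem_typeFinset hL)
      obtain ⟨h1', h2'⟩ := latMatrix_spec hn (index_ne_zero_of_mem_typeFinset hL')
      obtain ⟨U, hUe⟩ := QuotientGroup.rightRel_apply.1 (Quotient.exact h)
      have h3 : realGL (latMatrix L') = realGL (U.1 * latMatrix L) := by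
        rw [realGL_mul (hU U).ne_zero h1.ne', realGL_specialLinear, hUe, inv_mul_cancel_right]
      have h4 : latMatrix L' = U.1 * latMatrix L := by
        have h5 := congrArg (Units.val) h3
        rw [coe_realGL h1'.ne', coe_realGL (by
          rw [det_mul]; exact mul_ne_zero (hU U).ne_zero h1.ne')] at h5
        exact Matrix.map_injective Int.cast_injective h5
      rw [← h2, ← h2', h4, rowLat_unit_mul (hU U)]
    · rintro _ ⟨M, hM, rfl⟩
      obtain ⟨_, ⟨g, rfl⟩, _, ⟨h, rfl⟩, rfl⟩ := DoubleCoset.mem_doubleCoset.1 hM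
      have hd : 0 < (g.1 * (rowDiag n ((p : ℕ) ^ m) * h.1)).det := by
        rw [det_mul, det_mul, g.2, h.2, one_mul, mul_one]
        exact hdet'
      have hL := index_rowLat_ne_zero hd.ne'
      obtain ⟨h1, h2⟩ := latMatrix_spec hn hL
      refine ⟨rowLat (g.1 * (rowDiag n ((p : ℕ) ^ m) * h.1)), ?_, ?_⟩
      · rw [Finset.mem_coe, mem_typeFinset, rowLat_unit_mul (hU g)]
        obtain ⟨e⟩ := nonempty_quotient_rowDiag_equiv hn ((p : ℕ) ^ m) (hU h)
        exact (cyclicType p m).of_equiv e.symm ⟨inferInstance, Nat.card_zmod _⟩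
      · change (Quotient.mk _ (realGL (latMatrix _)) : CosetSpace n) = _
        rw [hcos h1 hd h2, realGL_mul (hU g).ne_zero (by
          rw [det_mul]; exact mul_ne_zero hdet (hU h).ne_zero), realGL_mul hdet (hU h).ne_zero,
          realGL_specialLinear, realGL_specialLinear, mul_assoc]

theorem latOp_eq_one {n : ℕ} (hn : 1 ≤ n) {Q : FiniteGroupType} {c : ℤ} (hc : 0 < c)
    (h : ∀ K : AddSubgroup (Fin n → ℤ), Q.mem ((Fin n → ℤ) ⧸ K) ↔
      K = rowLat (diagonal fun _ => c)) : latOp hn Q = 1 := by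
  have hd : 0 < (diagonal fun _ : Fin n => c).det := by
    rw [det_diagonal]
    exact Finset.prod_pos fun _ _ => hc
  have hT : typeFinset n Q = {rowLat (diagonal fun _ => c)} := by
    ext K
    rw [mem_typeFinset, Finset.mem_singleton, h]
  ext F x
  induction x using Quotient.inductionOn with
  | h z =>
    change latOp hn Q F (LocSym.mk z) = F (LocSym.mk z)
    rw [latOp_apply_mk, hT, Finset.sum_singleton, latValue_rowLat hn F z hd]
    have : realGL (diagonal fun _ : Fin n => c) =
        GeneralLinearGroup.scalar (Fin n) (Units.mk0 (c : ℝ) (by exact_mod_cast hc.ne')) := by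
      apply Units.ext
      rw [coe_realGL hd.ne', diagonal_map (by simp)]
      rfl
    rw [this, ProjGenLinGroup.mk_scalar, one_smul]

theorem latOp_eq_one_of_forall {n : ℕ} (hn : 1 ≤ n) {Q : FiniteGroupType}
    (h : ∀ K : AddSubgroup (Fin n → ℤ), Q.mem ((Fin n → ℤ) ⧸ K) ↔ K.index = 1) :
    latOp hn Q = 1 :=
  latOp_eq_one hn one_pos fun K => by
    rw [h, AddSubgroup.index_eq_one, show (diagonal fun _ : Fin n => (1 : ℤ)) = 1 from diagonal_one,
      rowLat_eq_top (by rw [det_one]; exact isUnit_one)]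

theorem latOp_cyclicType_zero {n : ℕ} (hn : 1 ≤ n) (p : ℕ) [Fact p.Prime] :
    latOp hn (cyclicType p 0) = 1 :=
  latOp_eq_one_of_forall hn fun K => by
    refine ⟨fun h => (h.2.trans (pow_zero p) : Nat.card _ = 1), fun h => ⟨?_, ?_⟩⟩
    · have : Subsingleton ((Fin n → ℤ) ⧸ K) := (Nat.card_eq_one_iff_unique.1 h).1
      infer_instance
    · rw [pow_zero]
      exact h

theorem latOp_elementaryType_zero {n : ℕ} (hn : 1 ≤ n) (p : ℕ) [Fact p.Prime] :
    latOp hn (elementaryType p 0) = 1 :=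
  latOp_eq_one_of_forall hn fun K => by
    refine ⟨fun h => (h.2.trans (pow_zero p) : Nat.card _ = 1), fun h => ⟨fun g => ?_, ?_⟩⟩
    · have : Subsingleton ((Fin n → ℤ) ⧸ K) := (Nat.card_eq_one_iff_unique.1 h).1
      exact Subsingleton.elim _ _
    · rw [pow_zero]
      exact h

/-- The only subgroup of `ℤⁿ` with elementary abelian quotient of order `p ^ n` is `p ℤⁿ`, and
scalar matrices act trivially. -/
theorem latOp_elementaryType_self {n : ℕ} (hn : 1 ≤ n) (p : ℕ) [hp : Fact p.Prime] :
    latOp hn (elementaryType p n) = 1 := by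
  have hmem : ∀ v : Fin n → ℤ, v ∈ rowLat (diagonal fun _ : Fin n => (p : ℤ)) ↔
      ∃ x : Fin n → ℤ, p • x = v := by
    intro v
    rw [mem_rowLat]
    refine exists_congr fun x => ?_
    suffices x ᵥ* (diagonal fun _ : Fin n => (p : ℤ)) = p • x by rw [this]
    ext i
    rw [vecMul_diagonal]
    simp [mul_comm]
  have hdet : (diagonal fun _ : Fin n => (p : ℤ)).det ≠ 0 := by
    rw [det_diagonal]
    exact Finset.prod_ne_zero_iff.2 fun _ _ => by exact_mod_cast hp.out.ne_zero
  have hcard : (rowLat (diagonal fun _ : Fin n => (p : ℤ))).index = p ^ n := by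
    let φ : (Fin n → ℤ) →+ (Fin n → ZMod p) := (Int.castAddHom (ZMod p)).compLeft (Fin n)
    have hφ : Function.Surjective φ := fun x =>
      ⟨fun i => (x i).cast, by ext i; simp [φ]⟩
    have hker : rowLat (diagonal fun _ : Fin n => (p : ℤ)) = φ.ker := by
      ext v
      rw [hmem, AddMonoidHom.mem_ker]
      have : φ v = 0 ↔ ∀ i, (p : ℤ) ∣ v i := by
        rw [funext_iff]
        exact forall_congr' fun i => ZMod.intCast_zmod_eq_zero_iff_dvd _ p
      rw [this]
      constructor
      · rintro ⟨x, rfl⟩ i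
        simp
      · intro h
        choose x hx using h
        exact ⟨x, by ext i; simp [hx i]⟩
    rw [hker, AddSubgroup.index_ker, AddMonoidHom.range_eq_top.2 hφ]
    simp
  refine latOp_eq_one hn (c := p) (by exact_mod_cast hp.out.pos) fun K => ⟨fun h => ?_, ?_⟩
  · have hle : rowLat (diagonal fun _ : Fin n => (p : ℤ)) ≤ K := by
      intro v hv
      obtain ⟨x, rfl⟩ := (hmem v).1 hv
      exact (QuotientAddGroup.eq_zero_iff _).1 (h.1 (x : (Fin n → ℤ) ⧸ K))
    have h1 := AddSubgroup.relIndex_mul_index hle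
    have h2 : K.index = p ^ n := h.2
    rw [h2, hcard] at h1
    have h3 := (mul_eq_right₀ (pow_ne_zero n hp.out.ne_zero)).1 h1
    exact le_antisymm (AddSubgroup.relIndex_eq_one.1 h3) hle
  · rintro rfl
    refine ⟨fun g => ?_, hcard⟩
    obtain ⟨x, rfl⟩ := QuotientAddGroup.mk_surjective g
    exact (QuotientAddGroup.eq_zero_iff _).2 ((hmem _).2 ⟨x, rfl⟩)

/-- The double coset of the scalar matrix `p` is a single coset, and scalars act trivially. -/
theorem heckeT_const_one {n : ℕ} (p : Nat.Primes) :
    heckeT p (fun _ : Fin n => (1 : ℤ)) = 1 := by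
  have hp : ((p : ℕ) : ℝ) ≠ 0 := Nat.cast_ne_zero.2 p.2.ne_zero
  have hA : diagPow p (fun _ : Fin n => (1 : ℤ)) =
      GeneralLinearGroup.scalar (Fin n) (Units.mk0 (p : ℝ) hp) := by
    apply Units.ext
    change diagonal _ = diagonal _
    simp
  have hcen : ∀ y : GL (Fin n) ℝ, diagPow p (fun _ : Fin n => (1 : ℤ)) * y =
      y * diagPow p (fun _ : Fin n => (1 : ℤ)) := by
    intro y
    have : diagPow p (fun _ : Fin n => (1 : ℤ)) ∈ Subgroup.center (GL (Fin n) ℝ) := by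
      rw [← ProjGenLinGroup.mk_eq_one, hA, ProjGenLinGroup.mk_scalar]
    exact (Subgroup.mem_center_iff.1 this y).symm
  have hcos : cosetsIn (diagPow p (fun _ : Fin n => (1 : ℤ))) =
      {Quotient.mk _ (diagPow p (fun _ : Fin n => (1 : ℤ)))} := by
    ext q
    rw [Set.mem_singleton_iff]
    constructor
    · rintro ⟨M, hM, rfl⟩
      obtain ⟨x, hx, y, hy, rfl⟩ := DoubleCoset.mem_doubleCoset.1 hM
      refine Quotient.sound (QuotientGroup.rightRel_apply.2 ?_)
      rw [mul_assoc x, hcen y, ← mul_assoc x, _root_.mul_inv_rev, mul_inv_cancel_left]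
      exact (gammaGL n).inv_mem ((gammaGL n).mul_mem hx hy)
    · rintro rfl
      exact ⟨_, DoubleCoset.mem_doubleCoset.2
        ⟨1, (gammaGL n).one_mem, 1, (gammaGL n).one_mem, by simp⟩, rfl⟩
  ext F x
  induction x using Quotient.inductionOn with
  | h z =>
    change cosetSum (diagPow p (fun _ : Fin n => (1 : ℤ))) F z = F (LocSym.mk z)
    rw [cosetSum, hcos, finsum_mem_singleton]
    change F (LocSym.mk (ProjGenLinGroup.mk _ • z)) = _
    rw [hA, ProjGenLinGroup.mk_scalar, one_smul]

theorem rat_smul_apply {n : ℕ} (q : ℚ) (T : Module.End ℂ (LocSym n → ℂ)) (F : LocSym n → ℂ)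
    (x : LocSym n) : (q • T) F x = (q : ℂ) * T F x := by
  rw [LinearMap.smul_apply, Pi.smul_apply, Rat.smul_def]

/-- The Hecke operators inherit the counting identity for finite abelian groups. -/
theorem latOp_recursion {n : ℕ} (hn : 1 ≤ n) (p : ℕ) [hp : Fact p.Prime] {N : ℕ} (hN : 1 ≤ N) :
    (1 - (p : ℚ)⁻¹ ^ N) • ((p : ℚ) ^ N.choose 2 • latOp hn (elementaryType p N)) =
      ∑ i ∈ Finset.range N, ((-1 : ℚ) ^ (N - 1 - i) * (1 - (p : ℚ)⁻¹)) •
        (((p : ℚ) ^ i.choose 2 • latOp hn (elementaryType p i)) *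
          latOp hn (cyclicType p (N - i))) := by
  classical
  ext F x
  induction x using Quotient.inductionOn with
  | h z =>
    have h1 : ∀ i ∈ Finset.range N, (((-1 : ℚ) ^ (N - 1 - i) * (1 - (p : ℚ)⁻¹)) •
        (((p : ℚ) ^ i.choose 2 • latOp hn (elementaryType p i)) *
          latOp hn (cyclicType p (N - i)))) F (LocSym.mk z) =
        ∑ K ∈ indexFinset n (p ^ N), (((-1 : ℚ) ^ (N - 1 - i) * (1 - (p : ℚ)⁻¹) *
          ((p : ℚ) ^ i.choose 2 * pairCount (elementaryType p i) (cyclicType p (N - i))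
            ((Fin n → ℤ) ⧸ K)) : ℚ) : ℂ) * latValue F z K := by
      intro i hi
      have hi := (Finset.mem_range.1 hi).le
      have ho : (elementaryType p i).order * (cyclicType p (N - i)).order = p ^ N :=
        pow_mul_pow_sub p hi
      rw [smul_mul_assoc, smul_smul, rat_smul_apply, latOp_mul_apply, ho, Finset.mul_sum]
      refine Finset.sum_congr rfl fun K _ => ?_
      push_cast
      ring
    change ((1 - (p : ℚ)⁻¹ ^ N) • ((p : ℚ) ^ N.choose 2 • latOp hn (elementaryType p N))) F
      (LocSym.mk z) = (∑ i ∈ Finset.range N, ((-1 : ℚ) ^ (N - 1 - i) * (1 - (p : ℚ)⁻¹)) •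
        (((p : ℚ) ^ i.choose 2 • latOp hn (elementaryType p i)) *
          latOp hn (cyclicType p (N - i)))) F (LocSym.mk z)
    rw [LinearMap.sum_apply, Finset.sum_apply, Finset.sum_congr rfl h1, Finset.sum_comm, smul_smul,
      rat_smul_apply, latOp_apply_eq_sum_indexFinset, Finset.mul_sum]
    refine Finset.sum_congr rfl fun K hK => ?_
    have hc : (p ^ N : ℕ) ≠ 0 := pow_ne_zero _ hp.out.ne_zero
    have hi : K.index = p ^ N := (mem_indexFinset hc).1 hK
    have : K.FiniteIndex := ⟨by rw [hi]; exact hc⟩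
    have : Finite ((Fin n → ℤ) ⧸ K) := inferInstance
    rw [← Finset.sum_mul, ← mul_assoc, ← Rat.cast_sum, ← sum_pairCount hN hi, ← Rat.cast_mul,
      mul_assoc]

end

/-! ### Solving the recursion -/

section

open Finset

/-- The partitions of `N` into at most `n` parts, as non-increasing `n`-tuples; for `N = n` this is
`partitionTuples n` by definition. -/
def sortedTuples (n N : ℕ) : Finset (Fin n → ℕ) :=
  (piAntidiag univ N).filter fun a => ∀ i j, i ≤ j → a j ≤ a i

theorem mem_sortedTuples {n N : ℕ} {a : Fin n → ℕ} :
    a ∈ sortedTuples n N ↔ ∑ j, a j = N ∧ ∀ i j, i ≤ j → a j ≤ a i := by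
  simp [sortedTuples, mem_piAntidiag]

/-- Adding a part to a partition that has a free place, and sorting. -/
theorem exists_insert_sortedTuples {n i k : ℕ} (h : i < n) {a : Fin n → ℕ}
    (ha : a ∈ sortedTuples n i) :
    ∃ b ∈ sortedTuples n (i + k), ∀ (S : Type) [CommRing S] (R : ℕ → S), R 0 = 1 →
      ∏ j, R (b j) = (∏ j, R (a j)) * R k := by
  obtain ⟨hsum, -⟩ := mem_sortedTuples.1 ha
  obtain ⟨o, ho⟩ : ∃ o, a o = 0 := by
    by_contra! hcon
    have : ∑ j : Fin n, 1 ≤ ∑ j, a j := sum_le_sum fun j _ => Nat.one_le_iff_ne_zero.2 (hcon j)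
    rw [hsum] at this
    simp at this
    omega
  let c := Function.update a o k
  let σ := Tuple.sort (OrderDual.toDual ∘ c)
  have hσ : Monotone ((OrderDual.toDual ∘ c) ∘ σ) := Tuple.monotone_sort _
  refine ⟨c ∘ σ, mem_sortedTuples.2 ⟨?_, fun i j hij => hσ hij⟩, fun S _ R hR => ?_⟩
  · rw [← hsum]
    refine (Equiv.sum_comp σ c).trans ?_
    rw [← add_sum_erase _ _ (mem_univ o), ← add_sum_erase _ a (mem_univ o), ho, zero_add, add_comm]
    congr 1
    · exact sum_congr rfl fun j hj => Function.update_of_ne (ne_of_mem_erase hj) _ _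
    · exact Function.update_self _ _ _
  · refine (Equiv.prod_comp σ fun j => R (c j)).trans ?_
    rw [← mul_prod_erase _ _ (mem_univ o), ← mul_prod_erase _ (fun j => R (a j)) (mem_univ o),
      ho, hR, one_mul, mul_comm]
    congr 1
    · exact prod_congr rfl fun j hj => by
        rw [show c j = a j from Function.update_of_ne (ne_of_mem_erase hj) _ _]
    · rw [show c o = k from Function.update_self _ _ _]

/-- The recursion `(1 - t ^ N) E_N = ∑_{i < N} (-1) ^ (N - 1 - i) (1 - t) E_i R_{N - i}` that links
elementary symmetric functions and one-row Hall–Littlewood functions, with `E_0 = R_0 = 1`. -/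
structure IsRowRecursion {S : Type} [CommRing S] [Algebra ℚ S] (t : ℚ) (R E : ℕ → S) : Prop where
  row_zero : R 0 = 1
  zero : E 0 = 1
  step : ∀ N, 1 ≤ N → (1 - t ^ N) • E N =
    ∑ i ∈ range N, ((-1 : ℚ) ^ (N - 1 - i) * (1 - t)) • (E i * R (N - i))

/-- The recursion expresses `E_N` through products of the `R_j`. The coefficients do not depend on
the ring, and they are bounded uniformly in `t`. -/
theorem exists_universal_coeff (n N : ℕ) (hN : N ≤ n) :
    ∃ C : ℚ, 0 ≤ C ∧ ∀ t : ℚ, 0 < t → t < 1 → ∃ y : (Fin n → ℕ) → ℚ, (∀ a, |y a| ≤ C) ∧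
      ∀ (S : Type) [CommRing S] [Algebra ℚ S] (R E : ℕ → S), IsRowRecursion t R E →
        E N = ∑ a ∈ sortedTuples n N, y a • ∏ j, R (a j) := by
  induction N using Nat.strong_induction_on with
  | _ N ih =>
  rcases Nat.eq_zero_or_pos N with rfl | hpos
  · refine ⟨1, zero_le_one, fun t _ _ => ⟨1, fun a => by simp, fun S _ _ R E h => ?_⟩⟩
    have : sortedTuples n 0 = {0} := by
      ext a
      rw [mem_sortedTuples, mem_singleton]
      constructor
      · rintro ⟨h, -⟩
        funext j
        exact (sum_eq_zero_iff.1 h) j (mem_univ j)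
      · rintro rfl
        simp
    rw [this, sum_singleton, h.zero]
    simp [h.row_zero]
  · have ih' : ∀ i, ∃ C : ℚ, i < N → 0 ≤ C ∧ ∀ t : ℚ, 0 < t → t < 1 →
        ∃ y : (Fin n → ℕ) → ℚ, (∀ a, |y a| ≤ C) ∧
        ∀ (S : Type) [CommRing S] [Algebra ℚ S] (R E : ℕ → S), IsRowRecursion t R E →
          E i = ∑ a ∈ sortedTuples n i, y a • ∏ j, R (a j) := fun i => by
      by_cases hi : i < N
      · obtain ⟨C, hC⟩ := ih i hi (hi.le.trans hN)
        exact ⟨C, fun _ => hC⟩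
      · exact ⟨0, fun h => absurd h hi⟩
    choose C hC using ih'
    have hins : ∀ (i : ℕ) (a : Fin n → ℕ), ∃ b, i < N → a ∈ sortedTuples n i →
        b ∈ sortedTuples n N ∧ ∀ (S : Type) [CommRing S] (R : ℕ → S), R 0 = 1 →
          ∏ j, R (b j) = (∏ j, R (a j)) * R (N - i) := fun i a => by
      by_cases h : i < N ∧ a ∈ sortedTuples n i
      · obtain ⟨b, hb, hb'⟩ := exists_insert_sortedTuples (k := N - i) (h.1.trans_le hN) h.2
        rw [Nat.add_sub_cancel' h.1.le] at hb
        exact ⟨b, fun _ _ => ⟨hb, hb'⟩⟩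
      · exact ⟨a, fun h1 h2 => absurd ⟨h1, h2⟩ h⟩
    choose ins hins using hins
    have hC0 : ∀ i ∈ range N, 0 ≤ ∑ a ∈ sortedTuples n i, C i := fun i hi =>
      sum_nonneg fun _ _ => (hC i (mem_range.1 hi)).1
    refine ⟨∑ i ∈ range N, ∑ a ∈ sortedTuples n i, C i, sum_nonneg hC0, fun t ht0 ht1 => ?_⟩
    have hy : ∀ i, ∃ y : (Fin n → ℕ) → ℚ, i < N → (∀ a, |y a| ≤ C i) ∧
        ∀ (S : Type) [CommRing S] [Algebra ℚ S] (R E : ℕ → S), IsRowRecursion t R E →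
          E i = ∑ a ∈ sortedTuples n i, y a • ∏ j, R (a j) := fun i => by
      by_cases hi : i < N
      · obtain ⟨y, hy⟩ := (hC i hi).2 t ht0 ht1
        exact ⟨y, fun _ => hy⟩
      · exact ⟨0, fun h => absurd h hi⟩
    choose y hy using hy
    have hd : 0 < 1 - t ^ N := sub_pos.2 (pow_lt_one₀ ht0.le ht1 (by omega))
    let w : ℕ → ℚ := fun i => (1 - t ^ N)⁻¹ * ((-1 : ℚ) ^ (N - 1 - i) * (1 - t))
    have hw : ∀ i, |w i| ≤ 1 := fun i => by
      have h1 : t ^ N ≤ t := pow_le_of_le_one ht0.le ht1.le (by omega)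
      rw [abs_mul, abs_mul, abs_pow, abs_neg, abs_one, one_pow, one_mul, abs_inv, abs_of_pos hd,
        abs_of_pos (sub_pos.2 ht1), inv_mul_le_one₀ hd]
      linarith
    refine ⟨fun b => ∑ i ∈ range N, ∑ a ∈ sortedTuples n i, if ins i a = b then w i * y i a else 0,
      fun b => ?_, fun S _ _ R E h => ?_⟩
    · refine (abs_sum_le_sum_abs _ _).trans (sum_le_sum fun i hi => ?_)
      refine (abs_sum_le_sum_abs _ _).trans (sum_le_sum fun a _ => ?_)
      split_ifs
      · rw [abs_mul]
        calc |w i| * |y i a| ≤ 1 * C i :=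
              mul_le_mul (hw i) ((hy i (mem_range.1 hi)).1 a) (abs_nonneg _) zero_le_one
          _ = C i := one_mul _
      · rw [abs_zero]
        exact (hC i (mem_range.1 hi)).1
    · have h1 : E N = ∑ i ∈ range N, ∑ a ∈ sortedTuples n i,
          (w i * y i a) • ∏ j, R (ins i a j) := by
        have h2 : E N = (1 - t ^ N)⁻¹ • ((1 - t ^ N) • E N) := by
          rw [smul_smul, inv_mul_cancel₀ hd.ne', one_smul]
        rw [h2, h.step N hpos, smul_sum]
        refine sum_congr rfl fun i hi => ?_
        rw [smul_smul, (hy i (mem_range.1 hi)).2 S R E h, sum_mul, smul_sum]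
        refine sum_congr rfl fun a ha => ?_
        rw [(hins i a (mem_range.1 hi) ha).2 S R h.row_zero, smul_mul_assoc, smul_smul]
      have h3 : ∀ b, (∑ i ∈ range N, ∑ a ∈ sortedTuples n i,
          if ins i a = b then w i * y i a else 0) • ∏ j, R (b j) =
          ∑ i ∈ range N, ∑ a ∈ sortedTuples n i,
            if ins i a = b then (w i * y i a) • ∏ j, R (ins i a j) else 0 := fun b => by
        rw [sum_smul]
        refine sum_congr rfl fun i _ => ?_
        rw [sum_smul]
        refine sum_congr rfl fun a _ => ?_
        split_ifs with hb
        · rw [hb]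
        · rw [zero_smul]
      rw [h1, sum_congr rfl fun b _ => h3 b, sum_comm]
      refine sum_congr rfl fun i hi => ?_
      rw [sum_comm]
      refine sum_congr rfl fun a ha => ?_
      rw [sum_ite_eq, if_pos (hins i a (mem_range.1 hi) ha).1]

/-- For `R_j = (-1) ^ (j - 1)` all terms of the recursion are positive, and `E_N ≥ 1`. -/
theorem exists_isRowRecursion_one_le {t : ℚ} (ht0 : 0 < t) (ht1 : t < 1) :
    ∃ R E : ℕ → ℚ, IsRowRecursion t R E ∧ (∀ j, |R j| ≤ 1) ∧ ∀ N, 1 ≤ E N := by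
  have hd : ∀ m, 0 < 1 - t ^ (m + 1) := fun m => sub_pos.2 (pow_lt_one₀ ht0.le ht1 (by omega))
  -- the partial sums `E_0 + ⋯ + E_m`
  let s : ℕ → ℚ := fun m => ∏ k ∈ range m, (1 + (1 - t) / (1 - t ^ (k + 1)))
  let E : ℕ → ℚ := fun N => if N = 0 then 1 else (1 - t) / (1 - t ^ N) * s (N - 1)
  have hE0 : E 0 = 1 := if_pos rfl
  have hE : ∀ m, E (m + 1) = (1 - t) / (1 - t ^ (m + 1)) * s m := fun m => if_neg m.succ_ne_zero
  have hs : ∀ m, ∑ i ∈ range (m + 1), E i = s m := by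
    intro m
    induction m with
    | zero => simp [s, hE0]
    | succ m ih =>
      rw [sum_range_succ, ih, hE]
      simp only [s, prod_range_succ]
      ring
  have hs1 : ∀ m, (1 - t ^ (m + 1)) / (1 - t) ≤ s m := by
    have ht : 0 < 1 - t := sub_pos.2 ht1
    intro m
    induction m with
    | zero => simp [s, ht.ne']
    | succ m ih =>
      have h1 : s (m + 1) = s m + s m * ((1 - t) / (1 - t ^ (m + 1))) := by
        simp only [s, prod_range_succ]
        ring
      have h2 : 1 ≤ s m * ((1 - t) / (1 - t ^ (m + 1))) := by
        calc (1 : ℚ) = (1 - t ^ (m + 1)) / (1 - t) * ((1 - t) / (1 - t ^ (m + 1))) := by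
              rw [div_mul_div_cancel₀ ht.ne', div_self (hd m).ne']
          _ ≤ _ := mul_le_mul_of_nonneg_right ih (div_pos ht (hd m)).le
      have h3 : (1 - t ^ (m + 1 + 1)) / (1 - t) = (1 - t ^ (m + 1)) / (1 - t) + t ^ (m + 1) := by
        rw [div_add' _ _ _ ht.ne']
        congr 1
        ring
      have h4 : t ^ (m + 1) ≤ 1 := pow_le_one₀ ht0.le ht1.le
      rw [h1, h3]
      exact add_le_add ih (h4.trans h2)
  refine ⟨fun j => if j = 0 then 1 else (-1) ^ (j - 1), E, ⟨if_pos rfl, hE0, fun N hN => ?_⟩,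
    fun j => ?_, fun N => ?_⟩
  · obtain ⟨m, rfl⟩ := Nat.exists_eq_add_of_le' hN
    have h1 : ∀ i ∈ range (m + 1), ((-1 : ℚ) ^ (m + 1 - 1 - i) * (1 - t)) •
        (E i * if m + 1 - i = 0 then 1 else (-1) ^ (m + 1 - i - 1)) = (1 - t) * E i := by
      intro i hi
      have hi := mem_range.1 hi
      rw [if_neg (by omega), show m + 1 - i - 1 = m - i by omega,
        show m + 1 - 1 - i = m - i by omega, smul_eq_mul]
      have : ((-1 : ℚ) ^ (m - i)) * (-1) ^ (m - i) = 1 := by rw [← mul_pow]; simp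
      linear_combination ((1 - t) * E i) * this
    rw [sum_congr rfl h1, ← mul_sum, hs, smul_eq_mul, hE, ← mul_assoc, mul_div_cancel₀ _ (hd m).ne']
  · dsimp only
    split_ifs <;> simp [abs_pow]
  · rcases N with _ | m
    · exact hE0.ge
    · rw [hE, ← div_le_iff₀' (div_pos (sub_pos.2 ht1) (hd m)), one_div_div]
      exact hs1 m

theorem sum_abs_le_card_mul_iSup {ι : Type*} {s : Finset ι} (y : s → ℝ) :
    ∑ a, |y a| ≤ (s.card : ℝ) * ⨆ a, |y a| := by
  have := sum_le_card_nsmul univ (fun a => |y a|) (⨆ a, |y a|)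
    fun a _ => le_ciSup (Set.finite_range fun a => |y a|).bddAbove a
  rwa [nsmul_eq_mul, card_univ, Fintype.card_coe] at this

/-- If a combination with coefficients `y` of products over the partitions of `n` is at least `1`,
then some factor is at least the reciprocal of `|Π(n)| max |y|`, provided that this reciprocal is at
most `1`. -/
theorem exists_factor_ge {n : ℕ} (hn : 1 ≤ n) (y : partitionTuples n → ℝ) (x : ℕ → ℝ)
    (hx : ∀ j, 0 ≤ x j) (hx0 : x 0 = 1) (hy : 1 ≤ ∑ a, |y a|)
    (h : 1 ≤ ∑ a : partitionTuples n, |y a| * ∏ j, x (a.1 j)) :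
    ∃ j, 1 ≤ j ∧ j ≤ n ∧ (((partitionTuples n).card : ℝ) * ⨆ a, |y a|)⁻¹ ≤ x j := by
  set X := (((partitionTuples n).card : ℝ) * ⨆ a, |y a|)⁻¹ with hX
  have hle := sum_abs_le_card_mul_iSup y
  have hpos : 0 < ((partitionTuples n).card : ℝ) * ⨆ a, |y a| := by linarith
  have hX1 : X ≤ 1 := inv_le_one_of_one_le₀ (hy.trans hle)
  by_contra! hcon
  have hx1 : ∀ j ≤ n, x j ≤ 1 := fun j hj => by
    rcases Nat.eq_zero_or_pos j with rfl | h0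
    · exact hx0.le
    · exact (hcon j h0 hj).le.trans hX1
  have hprod : ∀ a : partitionTuples n, ∏ j, x (a.1 j) < X := fun a => by
    have hsum : ∑ j, a.1 j = n := (mem_sortedTuples.1 a.2).1
    have hjn : ∀ j, a.1 j ≤ n := fun j => by
      conv_rhs => rw [← hsum]
      exact single_le_sum (f := a.1) (fun _ _ => Nat.zero_le _) (mem_univ j)
    obtain ⟨j, -, hj⟩ : ∃ j ∈ univ, a.1 j ≠ 0 := exists_ne_zero_of_sum_ne_zero (by omega)
    rw [← mul_prod_erase _ _ (mem_univ j)]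
    refine lt_of_le_of_lt (mul_le_of_le_one_right (hx _) ?_)
      (hcon _ (Nat.one_le_iff_ne_zero.2 hj) (hjn j))
    exact prod_le_one (fun _ _ => hx _) fun i _ => hx1 _ (hjn i)
  obtain ⟨a, -, ha⟩ : ∃ a ∈ univ, |y a| ≠ 0 := exists_ne_zero_of_sum_ne_zero (by linarith)
  have h1 : ∑ a : partitionTuples n, |y a| * ∏ j, x (a.1 j) < ∑ a, |y a| * X :=
    sum_lt_sum (fun b _ => mul_le_mul_of_nonneg_left (hprod b).le (abs_nonneg _))
      ⟨a, mem_univ a, mul_lt_mul_of_pos_left (hprod a) ((abs_nonneg _).lt_of_ne' ha)⟩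
  rw [← sum_mul] at h1
  have h2 : (∑ a, |y a|) * X ≤ 1 := by
    rw [hX, ← div_eq_mul_inv, div_le_one hpos]
    exact hle
  linarith

theorem list_prod_apply_eigenvector {V : Type} [AddCommGroup V] [Module ℂ V] {F : V} {k : ℕ}
    (T : Fin k → Module.End ℂ V) (μ : Fin k → ℂ) (h : ∀ j, T j F = μ j • F) :
    (List.ofFn T).prod F = (∏ j, μ j) • F := by
  induction k with
  | zero => simp
  | succ k ih =>
    rw [List.ofFn_succ, List.prod_cons, Module.End.mul_apply, ih _ _ fun j => h j.succ, map_smul, h,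
      smul_smul, Fin.prod_univ_succ, mul_comm]

end

/-! ### The identity of Hecke operators and its eigenvalues -/

section

open Finset

open scoped IsMulCommutative in
/-- `p ^ (n (n - 1) / 2)` times the identity as a combination of products of one-row Hecke
operators: the operators `latOp` generate a commutative ring, in which `latOp_recursion` is an
instance of `IsRowRecursion`, and `latOp hn (elementaryType p n)` is the identity. -/
theorem heckeT_one_eq_sum {n : ℕ} (hn : 1 ≤ n) (p : Nat.Primes) (y : (Fin n → ℕ) → ℚ)
    (hy : ∀ (S : Type) [CommRing S] [Algebra ℚ S] (R E : ℕ → S),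
      IsRowRecursion ((p : ℕ) : ℚ)⁻¹ R E → E n = ∑ a ∈ sortedTuples n n, y a • ∏ j, R (a j)) :
    ((p : ℕ) : ℚ) ^ n.choose 2 • (1 : Module.End ℂ (LocSym n → ℂ)) =
      ∑ a ∈ sortedTuples n n, y a • (List.ofFn fun j : Fin n => heckeRow n p (a j)).prod := by
  let s : Set (Module.End ℂ (LocSym n → ℂ)) := Set.range (latOp hn)
  have : IsMulCommutative (Algebra.adjoin ℚ s) := Algebra.isMulCommutative_adjoin ℚ (by
    rintro _ ⟨Q, rfl⟩ _ ⟨R, rfl⟩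
    exact latOp_commute hn Q R)
  let op : FiniteGroupType → Algebra.adjoin ℚ s := fun Q =>
    ⟨latOp hn Q, Algebra.subset_adjoin ⟨Q, rfl⟩⟩
  have hrec : IsRowRecursion ((p : ℕ) : ℚ)⁻¹ (fun j => op (cyclicType p j))
      (fun i => ((p : ℕ) : ℚ) ^ i.choose 2 • op (elementaryType p i)) := by
    refine ⟨Subtype.ext (latOp_cyclicType_zero hn p), ?_, fun N hN => ?_⟩
    · rw [Nat.choose_eq_zero_of_lt (by norm_num), pow_zero, one_smul]
      exact Subtype.ext (latOp_elementaryType_zero hn p)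
    · apply Subtype.ext
      refine (latOp_recursion hn p hN).trans ?_
      rw [AddSubmonoidClass.coe_finsetSum]
      rfl
  have h := congrArg (Algebra.adjoin ℚ s).val (hy _ _ _ hrec)
  rw [map_smul, map_sum] at h
  have h1 : (Algebra.adjoin ℚ s).val (op (elementaryType p n)) = 1 :=
    latOp_elementaryType_self hn p
  rw [h1] at h
  rw [h]
  refine sum_congr rfl fun a _ => ?_
  rw [map_smul, ← List.prod_ofFn, map_list_prod, List.map_ofFn]
  simp only [heckeRow_eq_latOp hn]
  rfl

theorem list_prod_heckeRow_apply {n : ℕ} (p : Nat.Primes) {F : LocSym n → ℂ}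
    {lam : Nat.Primes → (Fin n → ℤ) → ℂ} (hF : IsHeckeEigenform F lam) (a : Fin n → ℕ) :
    (List.ofFn fun j : Fin n => heckeRow n p (a j)).prod F =
      (∏ j, lam p (rowTuple n (a j))) • F :=
  list_prod_apply_eigenvector _ _ fun j => hF.eigen p (rowTuple n (a j))

theorem sum_prod_eigenvalue {n : ℕ} (p : Nat.Primes) (y : (Fin n → ℕ) → ℚ)
    (h : ((p : ℕ) : ℚ) ^ n.choose 2 • (1 : Module.End ℂ (LocSym n → ℂ)) =
      ∑ a ∈ sortedTuples n n, y a • (List.ofFn fun j : Fin n => heckeRow n p (a j)).prod)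
    {F : LocSym n → ℂ} {lam : Nat.Primes → (Fin n → ℤ) → ℂ} (hF : IsHeckeEigenform F lam) :
    ((p : ℕ) : ℂ) ^ n.choose 2 =
      ∑ a ∈ sortedTuples n n, (y a : ℂ) * ∏ j, lam p (rowTuple n (a j)) := by
  obtain ⟨x, hx⟩ := Function.ne_iff.1 hF.ne_zero
  have h1 := congrFun (congrArg (fun T : Module.End ℂ (LocSym n → ℂ) => T F) h) x
  simp only [LinearMap.sum_apply, Finset.sum_apply, rat_smul_apply,
    list_prod_heckeRow_apply p hF, Module.End.one_apply, Pi.smul_apply, smul_eq_mul,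
    ← mul_assoc, ← sum_mul] at h1
  have h2 := mul_right_cancel₀ hx h1
  push_cast at h2
  exact h2

/-- Dividing each eigenvalue `λ_{[j]}` by `p ^ (j (n - 1) / 2)` divides the relation between the
eigenvalues by `p ^ (n (n - 1) / 2)`. -/
theorem one_le_sum_normalized {n : ℕ} (p : Nat.Primes) (y : (Fin n → ℕ) → ℚ) (mu : ℕ → ℂ)
    (h : ((p : ℕ) : ℂ) ^ n.choose 2 = ∑ a ∈ sortedTuples n n, (y a : ℂ) * ∏ j, mu (a j)) :
    1 ≤ ∑ a ∈ sortedTuples n n,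
      |(y a : ℝ)| * ∏ j, (‖mu (a j)‖ / ((p : ℕ) : ℝ) ^ (((a j : ℕ) : ℝ) * ((n : ℝ) - 1) / 2)) := by
  have hp : 0 < ((p : ℕ) : ℝ) := Nat.cast_pos.2 p.2.pos
  have hP : 0 < ((p : ℕ) : ℝ) ^ n.choose 2 := pow_pos hp _
  have h1 : ∀ a ∈ sortedTuples n n,
      ∏ j, (‖mu (a j)‖ / ((p : ℕ) : ℝ) ^ (((a j : ℕ) : ℝ) * ((n : ℝ) - 1) / 2)) =
        (∏ j, ‖mu (a j)‖) / ((p : ℕ) : ℝ) ^ n.choose 2 := by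
    intro a ha
    rw [prod_div_distrib, ← Real.rpow_sum_of_pos hp, ← sum_div, ← sum_mul, ← Nat.cast_sum,
      (mem_sortedTuples.1 ha).1, ← Real.rpow_natCast _ (n.choose 2), Nat.cast_choose_two]
  rw [sum_congr rfl fun a ha => by rw [h1 a ha, ← mul_div_assoc], ← sum_div, one_le_div hP]
  calc ((p : ℕ) : ℝ) ^ n.choose 2 = ‖((p : ℕ) : ℂ) ^ n.choose 2‖ := by simp
    _ ≤ ∑ a ∈ sortedTuples n n, ‖(y a : ℂ) * ∏ j, mu (a j)‖ := by
        rw [h]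
        exact norm_sum_le _ _
    _ = _ := sum_congr rfl fun a _ => by
        rw [norm_mul, norm_prod, show ((y a : ℚ) : ℂ) = ((y a : ℝ) : ℂ) by push_cast; rfl,
          Complex.norm_real, Real.norm_eq_abs]

/-- Evaluating the universal identity at a solution with `|R_j| ≤ 1` and `E_n ≥ 1` bounds the
coefficients from below. -/
theorem one_le_sum_abs_coeff {n : ℕ} {t : ℚ} (ht0 : 0 < t) (ht1 : t < 1) (y : (Fin n → ℕ) → ℚ)
    (hy : ∀ (S : Type) [CommRing S] [Algebra ℚ S] (R E : ℕ → S),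
      IsRowRecursion t R E → E n = ∑ a ∈ sortedTuples n n, y a • ∏ j, R (a j)) :
    1 ≤ ∑ a ∈ sortedTuples n n, |y a| := by
  obtain ⟨R, E, hrec, hR, hE⟩ := exists_isRowRecursion_one_le ht0 ht1
  calc 1 ≤ E n := hE n
    _ ≤ |E n| := le_abs_self _
    _ ≤ ∑ a ∈ sortedTuples n n, |y a • ∏ j, R (a j)| := by
        rw [hy ℚ R E hrec]
        exact abs_sum_le_sum_abs _ _
    _ ≤ _ := sum_le_sum fun a _ => by
        rw [smul_eq_mul, abs_mul, abs_prod]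
        exact mul_le_of_le_one_right (abs_nonneg _)
          (prod_le_one (fun _ _ => abs_nonneg _) fun j _ => hR _)

end

end HeckePGL

end

theorem lemma2 (n : ℕ) (hn : 1 ≤ n) :
    ∃ C : ℝ, 0 < C ∧ ∃ c : ℝ, 0 < c ∧ ∃ P : ℕ, ∀ p : Nat.Primes, P ≤ (p : ℕ) →
      ∃ y : HeckePGL.partitionTuples n → ℚ,
        (∀ a, |(y a : ℝ)| ≤ C) ∧
        ((p : ℂ) ^ n • ∑ a : HeckePGL.partitionTuples n,
            (y a : ℂ) • (List.ofFn fun j : Fin n => HeckePGL.heckeRow n p (a.1 j)).prod)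
          = (p : ℂ) ^ (n * (n + 1) / 2) • HeckePGL.heckeT p (fun _ : Fin n => (1 : ℤ)) ∧
        HeckePGL.heckeT p (fun _ : Fin n => (1 : ℤ)) = 1 ∧
        ∀ (F : HeckePGL.LocSym n → ℂ) (lam : Nat.Primes → (Fin n → ℤ) → ℂ),
          HeckePGL.IsHeckeEigenform F lam →
          ∃ j : ℕ, 1 ≤ j ∧ j ≤ n ∧
            (((HeckePGL.partitionTuples n).card : ℝ) * ⨆ a, |(y a : ℝ)|)⁻¹
              ≤ ‖lam p (HeckePGL.rowTuple n j)‖ / (p : ℝ) ^ ((j : ℝ) * ((n : ℝ) - 1) / 2) ∧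
            c ≤ ‖lam p (HeckePGL.rowTuple n j)‖ / (p : ℝ) ^ ((j : ℝ) * ((n : ℝ) - 1) / 2) := by
  obtain ⟨C₀, hC₀, hC⟩ := HeckePGL.exists_universal_coeff n n le_rfl
  have hCpos : (0 : ℝ) < C₀ + 1 := by
    have : (0 : ℝ) ≤ C₀ := by exact_mod_cast hC₀
    linarith
  -- The second inequality follows from the first, as `max |y_a| ≤ C`. Adding `1` to the bound and to
  -- the cardinality makes positivity immediate.
  refine ⟨C₀ + 1, hCpos, (((HeckePGL.partitionTuples n).card + 1 : ℝ) * (C₀ + 1))⁻¹,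
    inv_pos.2 (mul_pos (by positivity) hCpos), 0, fun p _ => ?_⟩
  have hp0 : (0 : ℚ) < ((p : ℕ) : ℚ)⁻¹ := inv_pos.2 (Nat.cast_pos.2 p.2.pos)
  have hp1 : ((p : ℕ) : ℚ)⁻¹ < 1 := inv_lt_one_of_one_lt₀ (by exact_mod_cast p.2.one_lt)
  obtain ⟨y, hyC, hy⟩ := hC _ hp0 hp1
  have hop := HeckePGL.heckeT_one_eq_sum hn p y hy
  have hyC' : ∀ a, |(y a : ℝ)| ≤ C₀ + 1 := fun a => by
    have : |(y a : ℝ)| ≤ C₀ := by exact_mod_cast hyC a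
    linarith
  refine ⟨fun a => y a.1, fun a => hyC' a.1, ?_, HeckePGL.heckeT_const_one p,
    fun F lam hF => ?_⟩
  · rw [HeckePGL.heckeT_const_one, show n * (n + 1) / 2 = n + n.choose 2 by
      have h1 := Nat.choose_succ_succ' n 1
      rwa [Nat.choose_one_right, Nat.choose_two_right, Nat.add_sub_cancel, mul_comm] at h1,
      pow_add, mul_smul]
    congr 1
    have h1 : ∑ a : HeckePGL.partitionTuples n,
        (y a.1 : ℂ) • (List.ofFn fun j : Fin n => HeckePGL.heckeRow n p (a.1 j)).prod =
        ∑ a ∈ HeckePGL.sortedTuples n n,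
          (y a : ℂ) • (List.ofFn fun j : Fin n => HeckePGL.heckeRow n p (a j)).prod :=
      Finset.sum_coe_sort (HeckePGL.partitionTuples n) fun a =>
        (y a : ℂ) • (List.ofFn fun j : Fin n => HeckePGL.heckeRow n p (a j)).prod
    rw [h1]
    simp only [Rat.cast_smul_eq_qsmul]
    rw [← hop, ← Rat.cast_smul_eq_qsmul ℂ]
    push_cast
    rfl
  · have hlam0 : lam p (HeckePGL.rowTuple n 0) = 1 := by
      have h1 := hF.eigen p (HeckePGL.rowTuple n 0)
      have h2 : HeckePGL.heckeT p (HeckePGL.rowTuple n 0) = 1 :=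
        (HeckePGL.heckeRow_eq_latOp hn p 0).trans (HeckePGL.latOp_cyclicType_zero hn p)
      rw [h2, Module.End.one_apply] at h1
      obtain ⟨x, hx⟩ := Function.ne_iff.1 hF.ne_zero
      have h3 : F x = lam p (HeckePGL.rowTuple n 0) * F x := congrFun h1 x
      exact (mul_eq_right₀ hx).1 h3.symm
    have hsum := HeckePGL.sum_prod_eigenvalue p y hop hF
    have hnorm := HeckePGL.one_le_sum_normalized p y (fun j => lam p (HeckePGL.rowTuple n j)) hsum
    have habs := HeckePGL.one_le_sum_abs_coeff hp0 hp1 y hy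
    have habs' : 1 ≤ ∑ a : HeckePGL.partitionTuples n, |(y a.1 : ℝ)| := by
      refine le_of_le_of_eq ?_
        (Finset.sum_coe_sort (HeckePGL.partitionTuples n) fun a => |(y a : ℝ)|).symm
      exact_mod_cast habs
    obtain ⟨j, hj1, hjn, hj⟩ := HeckePGL.exists_factor_ge hn (fun a => (y a.1 : ℝ))
      (fun j => ‖lam p (HeckePGL.rowTuple n j)‖ / ((p : ℕ) : ℝ) ^ ((j : ℝ) * ((n : ℝ) - 1) / 2))
      (fun j => by positivity) (by simp [hlam0]) habs'
      (le_of_le_of_eq hnorm (Finset.sum_coe_sort (HeckePGL.partitionTuples n) fun a =>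
        |(y a : ℝ)| * ∏ j, (‖lam p (HeckePGL.rowTuple n (a j))‖ /
          ((p : ℕ) : ℝ) ^ (((a j : ℕ) : ℝ) * ((n : ℝ) - 1) / 2))).symm)
    refine ⟨j, hj1, hjn, hj, le_trans ?_ hj⟩
    have hle := HeckePGL.sum_abs_le_card_mul_iSup fun a : HeckePGL.partitionTuples n => (y a.1 : ℝ)
    refine inv_anti₀ (lt_of_lt_of_le one_pos (habs'.trans hle)) ?_
    refine mul_le_mul (by linarith) ?_ (Real.iSup_nonneg fun _ => abs_nonneg _) (by positivity)
    exact Real.iSup_le (fun a => hyC' a.1) hCpos.le
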